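/- Let $N\ge 1$. For each of the three ensembles below let $[dJ]$ be the flat Lebesgue measure over the independent complex entries of $J$ (with $d^2z=dx\,dy$), and let $$\langle \mathcal O(J)\rangle=\frac1Z\int [dJ]\,\mathcal O(J)\,e^{-\mathrm{Tr}(JJ^\dagger)},\qquad Z=\int[dJ]\,e^{-\mathrm{Tr}(JJ^\dagger)},$$ $$D_N(z,w^*)=\big\langle \det(z\mathbf 1-J)\,\det(w^*\mathbf 1-J^*)\big\rangle,$$ where $J^*$ is the entrywise complex conjugate and $J^\dagger$ the Hermitian conjugate of $J$. - Class A: $J$ is an arbitrary complex $N\times N$ matrix. - Class AI$^\dagger$: $J$ is a complex symmetric $N\times N$ matrix, $J=J^T$. - Class AII$^\dagger$: $J=\begin{pmatrix}A&B\\ C&A^T\end{pmatrix}$ is a complex self-dual $2N\times 2N$ matrix, with $A,B,C$ complex $N\times N$ matrices, $B^T=-B$, $C^T=-C$. Let $E_n(x)=\sum_{j=0}^n x^j/j!$ and $Q(a,x)=\Gamma(a,x)/\Gamma(a)$, where $\Gamma(a,x)=\int_x^\infty t^{a-1}e^{-t}\,dt$ is the upper incomplete Gamma function (for complex $x$ integrated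 along the ray $x+[0,\infty)$; for integer $a\ge 1$ this is an entire function of $x$). Then in each of the three classes the averages converge absolutely, $D_N(0,0)\neq0$, and for all $z,w\in\mathbb C$ $$\frac{D_N^{\rm A}(z,w^*)}{D_N^{\rm A}(0,0)}=E_N(zw^*)=e^{zw^*}Q(N+1,zw^*),$$ $$\frac{D_N^{\rm AI^\dagger}(z,w^*)}{D_N^{\rm AI^\dagger}(0,0)}=E_N(2zw^*)-\frac{2zw^*}{N+1}E_{N-1}(2zw^*)=e^{2zw^*}\Big(Q(N+1,2zw^*)-\frac{2zw^*}{N+1}Q(N,2zw^*)\Big),$$ $$\frac{D_N^{\rm AII^\dagger}(z,w^*)}{D_N^{\rm AII^\dagger}(0,0)}=\frac{N!}{(2N)!}\sum_{j=0}^N\frac{(2j)!}{j!}(4zw^*)^{N-j}E_{2j}(2zw^*)=e^{2zw^*}\frac{N!}{(2N)!}\sum_{j=0}^N\frac{(2j)!}{j!}(4zw^*)^{N-j}Q(2j+1,2zw^*).$$ -/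

import Mathlib

noncomputable section

namespace NonHermitian

open MeasureTheory

/-- The truncated exponential `E_n(x) = ∑_{j=0}^n x^j / j!`. -/
def truncExp (n : ℕ) (x : ℂ) : ℂ :=
  ∑ j ∈ Finset.range (n + 1), x ^ j / (j.factorial : ℂ)

/-- The upper incomplete Gamma function `Γ(a,x) = ∫_x^∞ t^(a-1) e^(-t) dt`, for complex `x`
integrated along the horizontal ray `t = x + s`, `s > 0`. For `a` a positive integer the
integrand is entire and this is the analytic continuation from `x > 0` to all of `ℂ`; in general
the ray does not cross the cut on the negative real axis, which gives the principal branch. -/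
def upperGamma (a x : ℂ) : ℂ :=
  ∫ s in Set.Ioi (0 : ℝ), (x + (s : ℂ)) ^ (a - 1) * Complex.exp (-(x + (s : ℂ)))

/-- The regularised upper incomplete Gamma function `Q(a,x) = Γ(a,x) / Γ(a)`. -/
def regGammaQ (a x : ℂ) : ℂ :=
  upperGamma a x / Complex.Gamma a

section Average

variable {n E : Type*} [Fintype n] [DecidableEq n]

/-- The unnormalised Gaussian weight `exp(-Tr (J J†))`. -/
def gaussWeight (J : Matrix n n ℂ) : ℂ :=
  Complex.exp (-(J * J.conjTranspose).trace)

/-- The partition function `Z = ∫ [dJ] exp(-Tr (J J†))` of the matrix space parametrised by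
`M : E → Matrix n n ℂ`, where `E` is the space of independent matrix entries carrying its flat
Lebesgue measure. -/
def partitionFn [MeasureSpace E] (M : E → Matrix n n ℂ) : ℂ :=
  ∫ e, gaussWeight (M e)

/-- The average `⟨O(J)⟩ = Z⁻¹ ∫ [dJ] O(J) exp(-Tr (J J†))`. -/
def average [MeasureSpace E] (M : E → Matrix n n ℂ) (O : Matrix n n ℂ → ℂ) : ℂ :=
  (partitionFn M)⁻¹ * ∫ e, O (M e) * gaussWeight (M e)

/-- The average `⟨O(J)⟩` converges: the weight and the weighted observable are (absolutely)
integrable. -/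
def AverageConverges [MeasureSpace E] (M : E → Matrix n n ℂ) (O : Matrix n n ℂ → ℂ) : Prop :=
  Integrable (fun e => gaussWeight (M e)) ∧
    Integrable (fun e => O (M e) * gaussWeight (M e))

/-- The observable `det(z 1 - J) det(v 1 - J*)`, with `J*` the entrywise complex conjugate. -/
def charPair (z v : ℂ) (J : Matrix n n ℂ) : ℂ :=
  (z • (1 : Matrix n n ℂ) - J).det * (v • (1 : Matrix n n ℂ) - J.map (starRingEnd ℂ)).det

end Average

/-- Class A: all `N^2` complex entries are independent. -/
def ginibre (N : ℕ) (e : Fin N → Fin N → ℂ) : Matrix (Fin N) (Fin N) ℂ :=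
  Matrix.of e

/-- Class AI†: the complex symmetric matrix with given entries on and above the diagonal. -/
def symMatrix (N : ℕ) (e : {p : Fin N × Fin N // p.1 ≤ p.2} → ℂ) : Matrix (Fin N) (Fin N) ℂ :=
  Matrix.of fun i j =>
    if h : i ≤ j then e ⟨(i, j), h⟩ else e ⟨(j, i), le_of_lt (not_le.mp h)⟩

/-- The complex antisymmetric matrix with given entries above the diagonal. -/
def antisymMatrix (N : ℕ) (e : {p : Fin N × Fin N // p.1 < p.2} → ℂ) :
    Matrix (Fin N) (Fin N) ℂ :=
  Matrix.of fun i j =>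
    if h : i < j then e ⟨(i, j), h⟩ else if h' : j < i then -e ⟨(j, i), h'⟩ else 0

/-- Class AII†: the complex self-dual `2N × 2N` matrix `[[A, B], [C, Aᵀ]]` with `A` arbitrary and
`B`, `C` antisymmetric. -/
def selfDual (N : ℕ)
    (e : (Fin N → Fin N → ℂ) ×
      (({p : Fin N × Fin N // p.1 < p.2} → ℂ) × ({p : Fin N × Fin N // p.1 < p.2} → ℂ))) :
    Matrix (Fin N ⊕ Fin N) (Fin N ⊕ Fin N) ℂ :=
  Matrix.fromBlocks (Matrix.of e.1) (antisymMatrix N e.2.1) (antisymMatrix N e.2.2)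
    (Matrix.of e.1).transpose

/-- `D_N(z, v) = ⟨det(z - J) det(v - J*)⟩` in class A. -/
def dA (N : ℕ) (z v : ℂ) : ℂ := average (ginibre N) (charPair z v)

/-- `D_N(z, v) = ⟨det(z - J) det(v - J*)⟩` in class AI†. -/
def dAI (N : ℕ) (z v : ℂ) : ℂ := average (symMatrix N) (charPair z v)

/-- `D_N(z, v) = ⟨det(z - J) det(v - J*)⟩` in class AII†. -/
def dAII (N : ℕ) (z v : ℂ) : ℂ := average (selfDual N) (charPair z v)

end NonHermitian

end

namespace NonHermitian

/-! ### Derivatives of determinants and adjugates -/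

section DetDerivation

open Matrix

/-! Integration against the complex Gaussian weight turns polynomials `f`, `g` in the independent
entries, with `f` evaluated at the entries and `g` at their conjugates, into a bilinear form `B(f,
g)` for which monomials are orthogonal and multiplication by a matrix entry is adjoint to
differentiation (`ProductCoords.integral_eq_fockForm`, `fockForm_X_mul`). Up to a sign that squares
to one, the average of the two characteristic polynomials is therefore `B(det(X - z), det(X - w*))`.
In class AII† one first multiplies by the symplectic unit: `X` becomes an antisymmetric matrix of
size `2N`, and the spectral parameter sits in the entries joining the partners `inl i` and `inr i`.

The shift by `z` is a product of one shift per index `i`, each a Taylor polynomial in a derivative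
`d i`. It has degree one in classes A and AI†, where second derivatives of the determinant vanish,
and degree two in class AII†, where the determinant is the square of a Pfaffian. The Euler operators
of the rows are self-adjoint, and they separate derivatives along different sets of indices by their
eigenvalues; hence all cross terms vanish (`form_shiftList`). What remains is a sum of squared norms
of derivatives of the determinant, weighted by powers of `z w*`.

Those norms satisfy recursions. Expanding a norm along a row by Euler's identity gives norms of
first derivatives; expanding again along the other index and using the exchange relations between
second derivatives of a determinant recovers the total Euler operator on the differentiated
polynomial, whose eigenvalue is its degree (`form_self`, `form_self_symm`, `form_D_antisymm`). In
class AII† a further count of equal first derivatives is needed (`norm_cons_right`). The exchange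
relations come from Jacobi's formulas for the adjugate, after multiplying by the determinant and
cancelling it in the polynomial domain.

The norms being factorials, the sums collapse to truncated exponentials; class AII† needs a
recurrence in `N` and a trinomial identity (`sum_selfDual`, `sum_trinomial`). Expanding `(x + s)^n`
inside the incomplete Gamma integral gives the second form of each answer. -/

theorem derivation_prod {k R n : Type*} [CommRing k] [CommRing R] [Algebra k R] [DecidableEq n]
    (D : Derivation k R R) (s : Finset n) (f : n → R) :
    D (∏ i ∈ s, f i) = ∑ i ∈ s, D (f i) * ∏ j ∈ s.erase i, f j := by
  induction s using Finset.induction_on with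
  | empty => simp
  | insert a s ha ih =>
    rw [Finset.prod_insert ha, Derivation.leibniz, ih, Finset.sum_insert ha,
      Finset.erase_insert ha, smul_eq_mul, smul_eq_mul, Finset.mul_sum, add_comm]
    congr 1
    · ring
    · refine Finset.sum_congr rfl fun i hi => ?_
      have hia : a ≠ i := fun h => ha (h ▸ hi)
      rw [Finset.erase_insert_of_ne hia, Finset.prod_insert (by simp [ha])]
      ring

variable {k R n : Type*} [CommRing k] [CommRing R] [Algebra k R] [Fintype n] [DecidableEq n]

theorem derivation_det (D : Derivation k R R) (A : Matrix n n R) :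
    D A.det = ∑ i, ∑ j, A.adjugate j i * D (A i j) := by
  have h1 : D A.det = ∑ j, (A.updateCol j fun i => D (A i j)).det := by
    simp only [det_apply', map_sum]
    rw [Finset.sum_comm]
    refine Finset.sum_congr rfl fun σ _ => ?_
    rw [← Finset.mul_sum, Derivation.leibniz, derivation_prod]
    simp only [smul_eq_mul, Derivation.map_intCast, mul_zero, add_zero]
    congr 1
    refine Finset.sum_congr rfl fun i _ => ?_
    rw [← Finset.mul_prod_erase _ _ (Finset.mem_univ i), updateCol_self]
    congr 1
    refine Finset.prod_congr rfl fun j hj => ?_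
    rw [updateCol_ne (Finset.ne_of_mem_erase hj)]
  rw [h1, Finset.sum_comm]
  refine Finset.sum_congr rfl fun j _ => ?_
  rw [← cramer_apply, cramer_eq_adjugate_mulVec]
  rfl

/-- Apply `D` to `A * adj A = det A • 1` and multiply by `adj A` on the left. Keeping the factor
`det A` avoids inverting `A`; it is cancelled later, in a domain. -/
theorem det_mul_derivation_adjugate (D : Derivation k R R) (A : Matrix n n R) (p q : n) :
    A.det * D (A.adjugate p q) =
      D A.det * A.adjugate p q - ∑ r, ∑ s, A.adjugate p r * D (A r s) * A.adjugate s q := by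
  have hmap : ∀ M M' : Matrix n n R, (M * M').map D = M.map D * M' + M * M'.map D := by
    intro M M'
    ext i j
    simp only [map_apply, mul_apply, Matrix.add_apply, map_sum, Derivation.leibniz, smul_eq_mul,
      Finset.sum_add_distrib]
    rw [add_comm]
    congr 1
    exact Finset.sum_congr rfl fun _ _ => mul_comm _ _
  have h1 := hmap A A.adjugate
  rw [mul_adjugate] at h1
  have h2 : (A.det • (1 : Matrix n n R)).map D = D A.det • (1 : Matrix n n R) := by
    ext i j
    by_cases h : i = j
    · subst h; simp
    · simp [h]
  rw [h2] at h1
  have h3 := congrArg (fun M => A.adjugate * M) h1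
  simp only [mul_add, ← mul_assoc, adjugate_mul] at h3
  have h4 := congrFun (congrFun h3 p) q
  simp only [Matrix.add_apply, Matrix.mul_smul, Matrix.mul_one, Matrix.smul_mul, Matrix.one_mul,
    Matrix.smul_apply, smul_eq_mul, map_apply] at h4
  rw [h4]
  have h5 : (A.adjugate * A.map D * A.adjugate) p q =
      ∑ r, ∑ s, A.adjugate p r * D (A r s) * A.adjugate s q := by
    simp only [mul_apply, Finset.sum_mul, map_apply]
    exact Finset.sum_comm
  rw [h5]
  ring

end DetDerivation

end NonHermitian

namespace NonHermitian

/-! ### Expansion of a shifted form into norms of derivatives -/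

section ShiftExpansion

/-- The coefficients of the expansion of a shifted form in terms of the norms `ν b c` of the
derivatives with `b` simple and `c` double derivatives. -/
noncomputable def shiftSum (ν : ℕ → ℕ → ℂ) (x : ℂ) : ℕ → ℕ → ℕ → ℂ
  | 0, b, c => ν b c
  | n + 1, b, c => shiftSum ν x n b c + x * shiftSum ν x n (b + 1) c
      + x ^ 2 / 4 * shiftSum ν x n b (c + 1)

variable {R ι : Type*} [AddCommGroup R] [Module ℂ R]

/-- Apply the operators `d i`, `i ∈ L`, one after the other. -/
def applyList (d : ι → R →ₗ[ℂ] R) (L : List ι) : R →ₗ[ℂ] R :=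
  L.foldr (fun i g => d i ∘ₗ g) LinearMap.id

/-- The derivative with simple derivatives along `L₁` and double derivatives along `L₂`. -/
def mixedDeriv (d : ι → R →ₗ[ℂ] R) (L₁ L₂ : List ι) : R →ₗ[ℂ] R :=
  applyList d L₁ ∘ₗ applyList (fun i => d i ∘ₗ d i) L₂

/-- Apply the shifts `T i`, `i ∈ L`. -/
def shiftList (T : ι → R →ₗ[ℂ] R) (L : List ι) : R →ₗ[ℂ] R :=
  L.foldr (fun i g => g ∘ₗ T i) LinearMap.id

@[simp] theorem applyList_nil (d : ι → R →ₗ[ℂ] R) (f : R) : applyList d [] f = f := rfl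

@[simp] theorem applyList_cons (d : ι → R →ₗ[ℂ] R) (i : ι) (L : List ι) (f : R) :
    applyList d (i :: L) f = d i (applyList d L f) := rfl

theorem map_applyList {d : ι → R →ₗ[ℂ] R} {e : R →ₗ[ℂ] R}
    (h : ∀ j g, e (d j g) = d j (e g)) (L : List ι) (f : R) :
    e (applyList d L f) = applyList d L (e f) := by
  induction L with
  | nil => rfl
  | cons j L ih => simp [h, ih]

theorem map_mixedDeriv {d : ι → R →ₗ[ℂ] R} {e : R →ₗ[ℂ] R}
    (h : ∀ j g, e (d j g) = d j (e g)) (f : R) (L₁ L₂ : List ι) :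
    e (mixedDeriv d L₁ L₂ f) = mixedDeriv d L₁ L₂ (e f) := by
  simp only [mixedDeriv, LinearMap.comp_apply]
  rw [map_applyList h, map_applyList fun j g => ?_]
  simp [h]

theorem mixedDeriv_cons_left (d : ι → R →ₗ[ℂ] R) (f : R) (i : ι) (L₁ L₂ : List ι) :
    mixedDeriv d (i :: L₁) L₂ f = d i (mixedDeriv d L₁ L₂ f) := rfl

theorem mixedDeriv_cons_right {d : ι → R →ₗ[ℂ] R} (hd : ∀ i j g, d i (d j g) = d j (d i g))
    (f : R) (i : ι) (L₁ L₂ : List ι) :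
    mixedDeriv d L₁ (i :: L₂) f = d i (d i (mixedDeriv d L₁ L₂ f)) := by
  simp only [mixedDeriv, LinearMap.comp_apply]
  rw [map_applyList (hd i), map_applyList (hd i)]
  rfl

theorem shiftList_eigen {T : ι → R →ₗ[ℂ] R} {E : R →ₗ[ℂ] R} (L : List ι)
    (h : ∀ j ∈ L, ∀ g, E (T j g) = T j (E g)) (f : R) :
    E (shiftList T L f) = shiftList T L (E f) := by
  induction L generalizing f with
  | nil => rfl
  | cons j L ih =>
    change E (shiftList T L (T j f)) = shiftList T L (T j (E f))
    rw [ih (fun k hk => h k (by simp [hk])), h j (by simp)]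

theorem form_eq_zero_of_eigen {B : R →ₗ[ℂ] R →ₗ[ℂ] ℂ} {E : R →ₗ[ℂ] R}
    (hE : ∀ f g, B (E f) g = B f (E g)) {f g : R} {l m : ℂ} (hf : E f = l • f) (hg : E g = m • g)
    (hlm : l ≠ m) : B f g = 0 := by
  have h := hE f g
  rw [hf, hg, map_smul, map_smul, LinearMap.smul_apply, smul_eq_mul, smul_eq_mul] at h
  have h2 : (l - m) * B f g = 0 := by linear_combination h
  exact (mul_eq_zero.mp h2).resolve_left (sub_ne_zero.mpr hlm)

theorem mixedDeriv_eigen [DecidableEq ι] {d : ι → R →ₗ[ℂ] R} {E : R →ₗ[ℂ] R} {i : ι}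
    (h : ∀ j g, j ≠ i → E (d j g) = d j (E g)) {f : R} {l : ℂ} (hf : E f = l • f)
    {L₁ L₂ : List ι} (h₁ : i ∉ L₁) (h₂ : i ∉ L₂) :
    E (mixedDeriv d L₁ L₂ f) = l • mixedDeriv d L₁ L₂ f := by
  simp only [mixedDeriv, LinearMap.comp_apply]
  induction L₁ with
  | nil =>
    induction L₂ with
    | nil => simpa using hf
    | cons j L ih =>
      have hj : j ≠ i := fun h => h₂ (by simp [h])
      have := ih (fun hh => h₂ (by simp [hh]))
      simp only [applyList_nil] at this
      simp [h j _ hj, this]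
  | cons j L ih =>
    have hj : j ≠ i := fun h => h₁ (by simp [h])
    rw [applyList_cons, h j _ hj, ih (fun hh => h₁ (by simp [hh])), map_smul]

/-- Peel off one shift `T z i` at a time. On a derivative of `f` along other indices it is a
quadratic polynomial in `d i`, and its three terms have the distinct `E i`-eigenvalues `l`, `l - s`,
`l - 2 * s`. The remaining shifts commute with the self-adjoint `E i`, so only the three diagonal
terms survive, with coefficients `1`, `z * v` and `(z ^ 2 / 2) * (v ^ 2 / 2)`; this is the recursion
of `shiftSum`. -/
theorem form_shiftList [DecidableEq ι] (B : R →ₗ[ℂ] R →ₗ[ℂ] ℂ) (d E : ι → R →ₗ[ℂ] R)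
    (T : ℂ → ι → R →ₗ[ℂ] R) (f : R) (l s : ℂ) (hs : s ≠ 0)
    (hd : ∀ i j g, d i (d j g) = d j (d i g))
    (hE : ∀ i f g, B (E i f) g = B f (E i g))
    (hEd : ∀ i j g, j ≠ i → E i (d j g) = d j (E i g))
    (hEd' : ∀ i g, E i (d i g) = d i (E i g) - s • d i g)
    (hEf : ∀ i, E i f = l • f)
    (hTd : ∀ z i j g, T z i (d j g) = d j (T z i g))
    (hTE : ∀ z i j g, j ≠ i → E i (T z j g) = T z j (E i g))
    (hTf : ∀ z i, T z i f = f - z • d i f + (z ^ 2 / 2) • d i (d i f))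
    (ν : ℕ → ℕ → ℂ)
    (hν : ∀ L₁ L₂ : List ι, (L₁ ++ L₂).Nodup →
      B (mixedDeriv d L₁ L₂ f) (mixedDeriv d L₁ L₂ f) = ν L₁.length L₂.length)
    (z v : ℂ) (S : List ι) :
    ∀ L₁ L₂ : List ι, (S ++ (L₁ ++ L₂)).Nodup →
      B (shiftList (T z) S (mixedDeriv d L₁ L₂ f)) (shiftList (T v) S (mixedDeriv d L₁ L₂ f))
        = shiftSum ν (z * v) S.length L₁.length L₂.length := by
  induction S with
  | nil => intro L₁ L₂ h; exact hν L₁ L₂ h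
  | cons i S ih =>
    intro L₁ L₂ h
    have hnd := h
    simp only [List.cons_append, List.nodup_cons, List.mem_append, not_or] at h
    obtain ⟨⟨hiS, hi₁, hi₂⟩, hS⟩ := h
    set F := mixedDeriv d L₁ L₂ f with hF
    have hT : ∀ z, T z i F = F - z • d i F + (z ^ 2 / 2) • d i (d i F) := by
      intro z
      rw [hF, map_mixedDeriv (hTd z i), hTf]
      have e1 := map_mixedDeriv (hd i) f L₁ L₂
      have e2 := map_mixedDeriv (hd i) (d i f) L₁ L₂
      rw [e1, e2]
      simp only [map_add, map_sub, map_smul]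
    have g0 : E i F = l • F := mixedDeriv_eigen (hEd i) (hEf i) hi₁ hi₂
    have g1 : E i (d i F) = (l - s) • d i F := by rw [hEd', g0, map_smul, sub_smul]
    have g2 : E i (d i (d i F)) = (l - 2 * s) • d i (d i F) := by
      rw [hEd', g1, map_smul, ← sub_smul]; congr 1; ring
    have hsh : ∀ z g, E i (shiftList (T z) S g) = shiftList (T z) S (E i g) := fun z g =>
      shiftList_eigen S (fun j hj g => hTE z i j g fun h => hiS (h ▸ hj)) g
    have horth : ∀ {p q : R} {a b : ℂ}, E i p = a • p → E i q = b • q → a ≠ b →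
        B (shiftList (T z) S p) (shiftList (T v) S q) = 0 := fun {p q a b} hp hq hab =>
      form_eq_zero_of_eigen (hE i) (by rw [hsh, hp, map_smul]) (by rw [hsh, hq, map_smul]) hab
    have n1 : l ≠ l - s := fun h => hs (by linear_combination h)
    have n2 : l ≠ l - 2 * s := fun h => hs (by linear_combination h / 2)
    have n3 : l - s ≠ l - 2 * s := fun h => hs (by linear_combination h)
    have i0 := ih L₁ L₂ hS
    -- The index leaves the list of shifts and joins the simple or the double derivatives, which is
    -- why the induction quantifies over `L₁` and `L₂`.
    have i1 := ih (i :: L₁) L₂ (by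
      refine hnd.perm ?_
      simpa using List.perm_middle.symm)
    have i2 := ih L₁ (i :: L₂) (by
      refine hnd.perm ?_
      have : (S ++ (L₁ ++ i :: L₂)) = (S ++ L₁) ++ i :: L₂ := by simp
      rw [this]
      refine List.Perm.trans ?_ List.perm_middle.symm
      simp)
    rw [mixedDeriv_cons_left] at i1
    rw [mixedDeriv_cons_right hd] at i2
    rw [← hF] at i0 i1 i2
    change B (shiftList (T z) S (T z i F)) (shiftList (T v) S (T v i F)) = _
    rw [hT, hT]
    simp only [map_add, map_sub, map_smul, LinearMap.add_apply, LinearMap.sub_apply,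
      LinearMap.smul_apply, smul_eq_mul]
    rw [horth g0 g1 n1, horth g0 g2 n2, horth g1 g0 n1.symm, horth g1 g2 n3, horth g2 g0 n2.symm,
      horth g2 g1 n3.symm, i1, i2, i0]
    simp only [List.length_cons, shiftSum]
    ring

end ShiftExpansion

end NonHermitian

/-! ### Gaussian integration by parts and polarised Euler operators -/

namespace NonHermitian

open Matrix

/-- A matrix `X` over a commutative algebra, derivations `D i j` and a symmetric bilinear form for
which multiplication by `X i j` is adjoint to `D i j`: the algebraic content of Gaussian
integration by parts. -/
structure WickSystem (n R : Type*) [Fintype n] [DecidableEq n] [CommRing R] [Algebra ℂ R] where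
  X : Matrix n n R
  D : n → n → Derivation ℂ R R
  B : R →ₗ[ℂ] R →ₗ[ℂ] ℂ
  D_comm : ∀ i j k l f, D i j (D k l f) = D k l (D i j f)
  B_symm : ∀ f g, B f g = B g f
  wick : ∀ i j f g, B (X i j * f) g = B f (D i j g)

namespace WickSystem

variable {n R : Type*} [Fintype n] [DecidableEq n] [CommRing R] [Algebra ℂ R]
variable (S : WickSystem n R)

/-- The polarised Euler operator `∑ m, X p m * D q m`. -/
noncomputable def rowOp (p q : n) : R →ₗ[ℂ] R :=
  ∑ m, LinearMap.mulLeft ℂ (S.X p m) ∘ₗ (S.D q m).toLinearMap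

theorem rowOp_apply (p q : n) (f : R) : S.rowOp p q f = ∑ m, S.X p m * S.D q m f := by
  simp [rowOp]

theorem form_rowOp (p q : n) (f g : R) :
    S.B (S.rowOp p q f) g = ∑ m, S.B (S.D q m f) (S.D p m g) := by
  simp [rowOp_apply, S.wick]

/-- Moving the factors `X p m` across the form puts one derivative on each side, an expression that
is symmetric under exchanging both `p, q` and `f, g`. -/
theorem form_rowOp_comm (p q : n) (f g : R) :
    S.B (S.rowOp p q f) g = S.B f (S.rowOp q p g) := by
  rw [S.B_symm f, form_rowOp, form_rowOp]
  exact Finset.sum_congr rfl fun _ _ => S.B_symm _ _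

theorem D_rowOp (k l p q : n) (f : R) :
    S.D k l (S.rowOp p q f) =
      S.rowOp p q (S.D k l f) + ∑ m, S.D k l (S.X p m) * S.D q m f := by
  simp only [rowOp_apply, map_sum, Derivation.leibniz, smul_eq_mul, Finset.sum_add_distrib]
  congr 1
  · exact Finset.sum_congr rfl fun m _ => by rw [S.D_comm]
  · exact Finset.sum_congr rfl fun m _ => mul_comm _ _

/-- The transposed system. -/
def transpose : WickSystem n R where
  X := S.Xᵀ
  D i j := S.D j i
  B := S.B
  D_comm _ _ _ _ f := S.D_comm _ _ _ _ f
  B_symm := S.B_symm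
  wick i j f g := S.wick j i f g

theorem sum_form_D (f g : R) :
    ∑ k, ∑ j, S.B (S.D k j f) (S.D k j g) = S.B (∑ k, S.rowOp k k f) g := by
  simp [form_rowOp]

/-- All entries of `X` are independent. -/
def IsGinibre : Prop :=
  ∀ i j k l, S.D i j (S.X k l) = (if i = k then 1 else 0) * (if j = l then 1 else 0)

/-- The entries of `X` satisfy `X j i = ε X i j` and are otherwise independent. -/
structure IsPaired (ε : R) : Prop where
  sq : ε * ε = 1
  X_swap : ∀ i j, S.X j i = ε * S.X i j
  D_swap : ∀ i j f, S.D j i f = ε * S.D i j f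
  D_X : ∀ i j k l, 2 * S.D i j (S.X k l) =
    (if i = k then 1 else 0) * (if j = l then 1 else 0)
      + ε * ((if i = l then 1 else 0) * (if j = k then 1 else 0))

/-- The derivations `D` as linear maps along a family of index pairs. -/
noncomputable def pairD {ι : Type*} (a b : ι → n) (i : ι) : R →ₗ[ℂ] R :=
  (S.D (a i) (b i)).toLinearMap

/-- Laplace expansion along a row: once the derivatives of the determinant are its cofactors, the
claim is `X * adj X = det X • 1`. -/
theorem rowOp_det (p q : n) (h : ∀ m, S.D q m S.X.det = S.X.adjugate m q) :
    S.rowOp p q S.X.det = if p = q then S.X.det else 0 := by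
  rw [rowOp_apply]
  simp only [h]
  have h2 := congrFun (congrFun (mul_adjugate S.X) p) q
  rw [mul_apply] at h2
  rw [h2, Matrix.smul_apply, one_apply]
  simp

/-! ### Independent entries: exchange relation and norm recursion -/

section Ginibre

variable {S}

namespace IsGinibre

theorem transpose (hS : S.IsGinibre) : S.transpose.IsGinibre := fun i j k l => by
  change S.D j i (S.X l k) = _
  rw [hS]
  ring

theorem D_rowOp (hS : S.IsGinibre) (k l p q : n) (f : R) :
    S.D k l (S.rowOp p q f) = S.rowOp p q (S.D k l f) + if k = p then S.D q l f else 0 := by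
  rw [WickSystem.D_rowOp]
  simp [hS _ _ _ _]

theorem D_det (hS : S.IsGinibre) (i j : n) : S.D i j S.X.det = S.X.adjugate j i := by
  rw [derivation_det]
  simp [hS _ _ _ _]

theorem det_mul_D_adjugate (hS : S.IsGinibre) (k l p q : n) :
    S.X.det * S.D k l (S.X.adjugate p q) =
      S.X.adjugate l k * S.X.adjugate p q - S.X.adjugate p k * S.X.adjugate l q := by
  rw [det_mul_derivation_adjugate, hS.D_det]
  simp [hS _ _ _ _]

/-- Second derivatives of the determinant are, after multiplication by it, the two by two minors of
the adjugate, and these change sign when two columns are exchanged. -/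
theorem D_D_det [IsDomain R] (hS : S.IsGinibre) (h0 : S.X.det ≠ 0) (i j k l : n) :
    S.D k l (S.D i j S.X.det) = - S.D k j (S.D i l S.X.det) := by
  apply mul_left_cancel₀ h0
  rw [mul_neg, hS.D_det, hS.D_det, hS.det_mul_D_adjugate, hS.det_mul_D_adjugate]
  ring

/-- Degree one in row `i` gives `B(g, g)` as the sum of the squared norms of `D i k g`. For `k ≠ i`,
`D i k g` is still of degree one in column `i`, so a second expansion followed by the exchange
relation gives the norms of `D j k (D i i g)`. Their sum over all `j, k` is `m` times the norm of `D
i i g`, by Euler's identity; the terms `k = i` missing from it vanish. -/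
theorem form_self (hS : S.IsGinibre) {g : R} {i : n} {m : ℂ} (h₁ : S.rowOp i i g = g)
    (h₂ : S.transpose.rowOp i i g = g)
    (h₃ : ∀ j k, S.D j i (S.D i k g) = - S.D j k (S.D i i g))
    (h₄ : ∑ k, S.rowOp k k (S.D i i g) = m • S.D i i g) :
    S.B g g = (1 + m) * S.B (S.D i i g) (S.D i i g) := by
  have e1 : S.B g g = ∑ k, S.B (S.D i k g) (S.D i k g) := by
    conv_lhs => rw [← h₁, h₁]
    nth_rw 1 [← h₁]
    rw [form_rowOp]
  have e2 : ∀ k, k ≠ i → S.B (S.D i k g) (S.D i k g) =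
      ∑ j, S.B (S.D j k (S.D i i g)) (S.D j k (S.D i i g)) := by
    intro k hk
    have h5 : S.transpose.rowOp i i (S.D i k g) = S.D i k g := by
      have := hS.transpose.D_rowOp k i i i g
      rw [if_neg hk, h₂, add_zero] at this
      exact this.symm
    have h6 := S.transpose.form_rowOp i i (S.D i k g) (S.D i k g)
    rw [h5] at h6
    change S.B _ _ = ∑ j, S.B (S.D j i (S.D i k g)) (S.D j i (S.D i k g)) at h6
    rw [h6]
    refine Finset.sum_congr rfl fun j _ => ?_
    rw [h₃]
    simp
  have e3 : ∑ j, S.B (S.D j i (S.D i i g)) (S.D j i (S.D i i g)) = 0 := by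
    refine Finset.sum_eq_zero fun j _ => ?_
    have h7 := h₃ j i
    have h8 : (2 : ℂ) • S.D j i (S.D i i g) = 0 := by
      rw [two_smul]
      nth_rw 1 [h7]
      simp
    have h9 := (smul_eq_zero.mp h8).resolve_left two_ne_zero
    rw [h9]
    simp
  have e4 := S.sum_form_D (S.D i i g) (S.D i i g)
  rw [h₄, Finset.sum_comm] at e4
  rw [e1, ← Finset.add_sum_erase _ _ (Finset.mem_univ i),
    Finset.sum_congr rfl fun k hk => e2 k (Finset.ne_of_mem_erase hk)]
  rw [← Finset.add_sum_erase _ _ (Finset.mem_univ i), e3, zero_add] at e4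
  rw [e4]
  simp
  ring

end IsGinibre

end Ginibre

/-! ### Symmetric and antisymmetric matrices: basic derivatives -/

section Paired

variable {S} {ε : R}

namespace IsPaired

/-- The entry `k l` lies in row `k` and, as its mirror image, in row `l`, each time with weight one
half. The factor 2 clears the halves. -/
theorem two_mul_D_rowOp (hS : S.IsPaired ε) (k l p q : n) (f : R) :
    2 * S.D k l (S.rowOp p q f) = 2 * S.rowOp p q (S.D k l f)
      + ((if k = p then S.D q l f else 0) + ε * (if l = p then S.D q k f else 0)) := by
  rw [WickSystem.D_rowOp, mul_add, Finset.mul_sum]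
  congr 1
  simp only [← mul_assoc, hS.D_X, add_mul, Finset.sum_add_distrib]
  congr 1
  · simp
  · rw [Finset.sum_eq_single k]
    · simp
    · intro b _ hb
      simp [hb.symm]
    · simp

theorem two_mul_D_det (hS : S.IsPaired ε) (i j : n) :
    2 * S.D i j S.X.det = S.X.adjugate j i + ε * S.X.adjugate i j := by
  rw [derivation_det, Finset.mul_sum]
  simp only [Finset.mul_sum, mul_left_comm (2 : R), hS.D_X, mul_add, Finset.sum_add_distrib]
  congr 1
  · simp
  · rw [Finset.sum_eq_single j]
    · simp [mul_comm]
    · intro b _ hb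
      simp [hb.symm]
    · simp

theorem D_det [IsDomain R] (hS : S.IsPaired ε)
    (ha : ∀ i j, S.X.adjugate j i = ε * S.X.adjugate i j) (i j : n) :
    S.D i j S.X.det = S.X.adjugate j i := by
  have h := hS.two_mul_D_det i j
  rw [← ha] at h
  have : CharZero R := charZero_of_injective_algebraMap (algebraMap ℂ R).injective
  exact mul_left_cancel₀ (two_ne_zero' R) (by rw [h]; ring)

theorem two_mul_det_mul_D_adjugate [IsDomain R] (hS : S.IsPaired ε)
    (ha : ∀ i j, S.X.adjugate j i = ε * S.X.adjugate i j) (k l p q : n) :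
    2 * (S.X.det * S.D k l (S.X.adjugate p q)) = 2 * (S.X.adjugate l k * S.X.adjugate p q)
      - (S.X.adjugate p k * S.X.adjugate l q + ε * (S.X.adjugate p l * S.X.adjugate k q)) := by
  rw [det_mul_derivation_adjugate, hS.D_det ha, mul_sub, Finset.mul_sum]
  congr 1
  have : ∀ r s, 2 * (S.X.adjugate p r * S.D k l (S.X r s) * S.X.adjugate s q) =
      S.X.adjugate p r * (2 * S.D k l (S.X r s)) * S.X.adjugate s q := fun _ _ => by ring
  simp only [Finset.mul_sum, this, hS.D_X, mul_add, add_mul, Finset.sum_add_distrib]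
  congr 1
  · simp
  · rw [Finset.sum_eq_single l]
    · rw [Finset.sum_eq_single k]
      · simp
        ring
      · intro b _ hb
        simp [hb.symm]
      · simp
    · intro b _ hb
      simp [hb.symm]
    · simp

end IsPaired

end Paired

end WickSystem

end NonHermitian

/-! ### Symmetric and antisymmetric matrices: exchange relations and norm recursions -/

namespace NonHermitian

open Matrix

namespace WickSystem

variable {n R : Type*} [Fintype n] [DecidableEq n] [CommRing R] [Algebra ℂ R]
variable {S : WickSystem n R} {ε : R}

/-- The exchange relations for paired entries carry a factor `-1/2`, hence `1/4` for squared norms.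
-/
theorem four_mul_form {f g : R} (h : 2 * f = -g) : 4 * S.B f f = S.B g g := by
  have : g = (-2 : ℂ) • f := by
    rw [neg_smul, two_smul, ← two_mul, h, neg_neg]
  rw [this]
  simp
  ring

theorem IsPaired.degree_D [IsDomain R] (hS : S.IsPaired ε) (k l : n) (f : R) :
    ∑ p, S.rowOp p p (S.D k l f) = S.D k l (∑ p, S.rowOp p p f) - S.D k l f := by
  have : CharZero R := charZero_of_injective_algebraMap (algebraMap ℂ R).injective
  apply mul_left_cancel₀ (two_ne_zero' R)
  rw [map_sum, mul_sub, Finset.mul_sum, Finset.mul_sum]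
  simp only [hS.two_mul_D_rowOp, Finset.sum_add_distrib]
  simp [hS.D_swap k l, ← mul_assoc, hS.sq]
  ring

theorem IsGinibre.degree_D (hS : S.IsGinibre) (k l : n) (f : R) :
    ∑ p, S.rowOp p p (S.D k l f) = S.D k l (∑ p, S.rowOp p p f) - S.D k l f := by
  rw [map_sum]
  simp only [hS.D_rowOp, Finset.sum_add_distrib]
  simp

namespace IsPaired

section Symmetric

theorem adjugate_symm (hS : S.IsPaired 1) (i j : n) :
    S.X.adjugate j i = 1 * S.X.adjugate i j := by
  have : S.X.IsSymm := Matrix.IsSymm.ext fun i j => by rw [hS.X_swap i j, one_mul]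
  rw [one_mul, this.adjugate.apply]

theorem two_mul_D_D_det [IsDomain R] (hS : S.IsPaired 1) (h0 : S.X.det ≠ 0) (i j k : n) :
    2 * S.D i j (S.D i k S.X.det) = - S.D i i (S.D j k S.X.det) := by
  have : CharZero R := charZero_of_injective_algebraMap (algebraMap ℂ R).injective
  apply mul_left_cancel₀ (two_ne_zero' R)
  apply mul_left_cancel₀ h0
  have ha := hS.adjugate_symm
  rw [hS.D_det ha, hS.D_det ha]
  have e1 := hS.two_mul_det_mul_D_adjugate ha i j k i
  have e2 := hS.two_mul_det_mul_D_adjugate ha i i k j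
  have e3 := ha i j
  linear_combination 2 * e1 + e2 + 2 * (S.X.adjugate k i) * e3

/-- The double expansion of `IsGinibre.form_self`, with changed weights. For `k ≠ i`, `D i k`
removes only half a unit of degree from row `i`, so the second expansion has a factor 2; the
exchange relation contributes `1/4`. Together they turn `m` into `m / 2`. -/
theorem form_self_symm [IsDomain R] (hS : S.IsPaired 1) {g : R} {i : n} {m : ℂ}
    (h₁ : S.rowOp i i g = g)
    (h₃ : ∀ j k, 2 * S.D i j (S.D i k g) = - S.D j k (S.D i i g))
    (h₄ : ∑ k, S.rowOp k k (S.D i i g) = m • S.D i i g) :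
    S.B g g = (1 + m / 2) * S.B (S.D i i g) (S.D i i g) := by
  have : CharZero R := charZero_of_injective_algebraMap (algebraMap ℂ R).injective
  have e1 : S.B g g = ∑ k, S.B (S.D i k g) (S.D i k g) := by
    nth_rw 1 [← h₁]
    rw [form_rowOp]
  have e2 : ∀ k, k ≠ i → S.B (S.D i k g) (S.D i k g) =
      1 / 2 * ∑ j, S.B (S.D j k (S.D i i g)) (S.D j k (S.D i i g)) := by
    intro k hk
    have h5 : 2 * S.rowOp i i (S.D i k g) = S.D i k g := by
      have := hS.two_mul_D_rowOp i k i i g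
      rw [if_neg hk, if_pos rfl, h₁] at this
      linear_combination -this
    have h6 := S.form_rowOp i i (S.D i k g) (S.D i k g)
    have h7 : S.B (S.D i k g) (S.D i k g) = 2 * S.B (S.rowOp i i (S.D i k g)) (S.D i k g) := by
      nth_rw 1 [← h5]
      rw [two_mul, map_add, LinearMap.add_apply, two_mul]
    rw [h7, h6, Finset.mul_sum, Finset.mul_sum]
    refine Finset.sum_congr rfl fun j _ => ?_
    rw [← four_mul_form (h₃ j k)]
    ring
  -- For `k = i` both sides of the exchange relation contain the same derivative, with coefficients
  -- `2` and `-1`, so three times it is zero.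
  have e3 : ∑ j, S.B (S.D j i (S.D i i g)) (S.D j i (S.D i i g)) = 0 := by
    refine Finset.sum_eq_zero fun j _ => ?_
    have h7 := h₃ j i
    rw [S.D_comm i j] at h7
    have h10 : S.D i j (S.D i i g) = S.D j i (S.D i i g) := by rw [hS.D_swap j i, one_mul]
    have h8 : 3 * S.D j i (S.D i i g) = 0 := by
      rw [S.D_comm i i, h10] at h7
      linear_combination h7
    have h9 := (mul_eq_zero.mp h8).resolve_left (by norm_num)
    rw [h9]
    simp
  have e4 := S.sum_form_D (S.D i i g) (S.D i i g)
  rw [h₄, Finset.sum_comm] at e4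
  rw [e1, ← Finset.add_sum_erase _ _ (Finset.mem_univ i),
    Finset.sum_congr rfl fun k hk => e2 k (Finset.ne_of_mem_erase hk), ← Finset.mul_sum]
  rw [← Finset.add_sum_erase _ _ (Finset.mem_univ i), e3, zero_add] at e4
  rw [e4]
  simp
  ring

end Symmetric

section Antisymmetric

theorem adjugate_antisymm (hS : S.IsPaired (-1)) (hn : Even (Fintype.card n)) (i j : n) :
    S.X.adjugate j i = -1 * S.X.adjugate i j := by
  rcases isEmpty_or_nonempty n with h | h
  · exact h.elim i
  have h1 : S.Xᵀ = (-1 : R) • S.X := by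
    ext i j
    simp [hS.X_swap i j]
  have h2 := congrFun (congrFun (adjugate_transpose S.X) i) j
  rw [h1, adjugate_smul, transpose_apply, Matrix.smul_apply, Odd.neg_one_pow] at h2
  · exact h2
  · exact Nat.Even.sub_odd Fintype.card_pos hn odd_one

theorem D_self_eq_zero [IsDomain R] (hS : S.IsPaired (-1)) (i : n) (f : R) : S.D i i f = 0 := by
  have : CharZero R := charZero_of_injective_algebraMap (algebraMap ℂ R).injective
  have h := hS.D_swap i i f
  have : (2 : R) * S.D i i f = 0 := by linear_combination h
  exact (mul_eq_zero.mp this).resolve_left two_ne_zero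

/-- The determinant is a Pfaffian squared, so its second derivatives are governed by products of
entries of the adjugate: `eH` and `eK` below. Differentiating these two identities once more and
eliminating first derivatives of the adjugate gives the relation between third derivatives, after
multiplication by `4 * det ^ 2`. -/
theorem two_mul_D_D_D_det [IsDomain R] (hS : S.IsPaired (-1)) (hn : Even (Fintype.card n))
    (h0 : S.X.det ≠ 0) (a b i j : n) :
    2 * S.D a i (S.D b j (S.D a b S.X.det)) = - S.D i j (S.D a b (S.D a b S.X.det)) := by
  have : CharZero R := charZero_of_injective_algebraMap (algebraMap ℂ R).injective
  have ha := hS.adjugate_antisymm hn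
  have hz : ∀ i, S.X.adjugate i i = 0 := fun i => by
    have : (2 : R) * S.X.adjugate i i = 0 := by linear_combination ha i i
    exact (mul_eq_zero.mp this).resolve_left two_ne_zero
  have eH : 2 * (S.X.det * S.D a b (S.D a b S.X.det)) = S.X.adjugate b a * S.X.adjugate b a := by
    rw [hS.D_det ha, hS.two_mul_det_mul_D_adjugate ha, hz, hz]
    ring
  have eK : 2 * (S.X.det * S.D b j (S.D a b S.X.det)) =
      -(S.X.adjugate b j * S.X.adjugate b a) := by
    rw [hS.D_det ha, hS.two_mul_det_mul_D_adjugate ha, hz, ha b j]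
    ring
  have two : ∀ D : Derivation ℂ R R, D 2 = 0 := fun D => D.map_natCast 2
  have eHD := congrArg (S.D i j) eH
  have eKD := congrArg (S.D a i) eK
  simp only [Derivation.leibniz, smul_eq_mul, two, map_neg, hS.D_det ha i j, hS.D_det ha a i]
    at eHD eKD
  have f1 := hS.two_mul_det_mul_D_adjugate ha i j b a
  have f2 := hS.two_mul_det_mul_D_adjugate ha a i b a
  have f3 := hS.two_mul_det_mul_D_adjugate ha a i b j
  rw [hz] at f2
  rw [ha j i, ha j a] at f3
  apply mul_left_cancel₀ (mul_ne_zero (mul_ne_zero (by norm_num) h0) h0 :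
    (4 : R) * S.X.det * S.X.det ≠ 0)
  linear_combination 4 * S.X.det * eKD - 2 * S.X.adjugate b j * f2 - 2 * S.X.adjugate b a * f3
    - 4 * S.X.adjugate i a * eK + 2 * S.X.det * eHD + 2 * S.X.adjugate b a * f1
    - 2 * S.X.adjugate j i * eH

theorem D_D_D_eq_zero [IsDomain R] {g : R} {a b : n}
    (h : ∀ i j, 2 * S.D a i (S.D b j (S.D a b g)) = - S.D i j (S.D a b (S.D a b g))) (j : n) :
    S.D b j (S.D a b (S.D a b g)) = 0 := by
  have : CharZero R := charZero_of_injective_algebraMap (algebraMap ℂ R).injective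
  have h1 := h b j
  rw [S.D_comm a b b j] at h1
  have h2 : 3 * S.D b j (S.D a b (S.D a b g)) = 0 := by linear_combination h1
  exact (mul_eq_zero.mp h2).resolve_left (by norm_num)

/-- With `u = D a b g`, the weight of `u` in each of the rows `a` and `b` is one half. Expand the
norm of `u` along row `a`. The term `i = b` gives twice the norm of `D a b u`; the others, expanded
along row `b` and rewritten by the exchange relation, add up to the Euler operator on `D a b u`,
that is `m` times its norm. -/
theorem form_D_antisymm [IsDomain R] (hS : S.IsPaired (-1)) {g : R} {a b : n} {m : ℂ}
    (hab : a ≠ b) (ha : S.rowOp a a g = g) (hb : S.rowOp b b g = g)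
    (h₃ : ∀ i j, 2 * S.D a i (S.D b j (S.D a b g)) = - S.D i j (S.D a b (S.D a b g)))
    (h₄ : ∑ k, S.rowOp k k (S.D a b (S.D a b g)) = m • S.D a b (S.D a b g)) :
    S.B (S.D a b g) (S.D a b g) =
      (2 + m) * S.B (S.D a b (S.D a b g)) (S.D a b (S.D a b g)) := by
  have : CharZero R := charZero_of_injective_algebraMap (algebraMap ℂ R).injective
  set u := S.D a b g with hu
  have hua : 2 * S.rowOp a a u = u := by
    have := hS.two_mul_D_rowOp a b a a g
    rw [if_pos rfl, if_neg hab.symm, ha, mul_zero, add_zero] at this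
    linear_combination -this
  have hub : 2 * S.rowOp b b u = u := by
    have := hS.two_mul_D_rowOp a b b b g
    rw [if_pos rfl, if_neg hab, hb, hS.D_swap a b] at this
    linear_combination -this
  have key : ∀ c w, 2 * S.rowOp c c w = w → S.B w w = 2 * ∑ j, S.B (S.D c j w) (S.D c j w) := by
    intro c w hw
    rw [← S.form_rowOp c c w w]
    nth_rw 1 [← hw]
    rw [two_mul, map_add, LinearMap.add_apply, two_mul]
  have e2 : ∀ i, i ≠ b → S.B (S.D a i u) (S.D a i u) =
      1 / 2 * ∑ j, S.B (S.D i j (S.D a b u)) (S.D i j (S.D a b u)) := by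
    intro i hi
    have hw : 2 * S.rowOp b b (S.D a i u) = S.D a i u := by
      have h5 := hS.two_mul_D_rowOp a i b b u
      rw [if_neg hab, if_neg hi, mul_zero, add_zero, add_zero] at h5
      have h6 := congrArg (S.D a i) hub
      rw [Derivation.leibniz] at h6
      have h7 : S.D a i 2 = 0 := (S.D a i).map_natCast 2
      rw [h7, smul_zero, add_zero, smul_eq_mul] at h6
      rw [← h5, h6]
    rw [key b _ hw, Finset.mul_sum, Finset.mul_sum]
    refine Finset.sum_congr rfl fun j _ => ?_
    rw [← four_mul_form (h₃ i j), S.D_comm b j a i]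
    ring
  have e3 : ∑ j, S.B (S.D b j (S.D a b u)) (S.D b j (S.D a b u)) = 0 := by
    refine Finset.sum_eq_zero fun j _ => ?_
    rw [D_D_D_eq_zero h₃]
    simp
  have e4 := S.sum_form_D (S.D a b u) (S.D a b u)
  rw [h₄, ← Finset.add_sum_erase _ _ (Finset.mem_univ b), e3, zero_add] at e4
  rw [key a u hua, ← Finset.add_sum_erase _ _ (Finset.mem_univ b),
    Finset.sum_congr rfl fun k hk => e2 k (Finset.ne_of_mem_erase hk), ← Finset.mul_sum, e4]
  simp
  ring

/-- Up to the factor `-1/2`, `rowOp b k` carries `D a b g` to `D a k g` and its adjoint `rowOp k b`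
carries it back, so the two norms agree. -/
theorem form_D_eq (hS : S.IsPaired (-1)) {g : R} {a b k : n} (hab : a ≠ b) (hak : a ≠ k)
    (hbk : S.rowOp b k g = 0) (hkb : S.rowOp k b g = 0) :
    S.B (S.D a k g) (S.D a k g) = S.B (S.D a b g) (S.D a b g) := by
  have h1 := hS.two_mul_D_rowOp a b b k g
  have h2 := hS.two_mul_D_rowOp a k k b g
  rw [hbk, if_neg hab, if_pos rfl, hS.D_swap a k, map_zero] at h1
  rw [hkb, if_neg hak, if_pos rfl, hS.D_swap a b, map_zero] at h2
  have h1' : 2 * S.rowOp b k (S.D a b g) = - S.D a k g := by linear_combination -h1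
  have h2' : 2 * S.rowOp k b (S.D a k g) = - S.D a b g := by linear_combination -h2
  have h3 := S.form_rowOp_comm b k (S.D a b g) (S.D a k g)
  have h4 : S.B (- S.D a k g) (S.D a k g) = S.B (S.D a b g) (- S.D a b g) := by
    rw [← h1', ← h2', two_mul, two_mul, map_add, map_add, LinearMap.add_apply, h3]
  simpa using h4

end Antisymmetric

end IsPaired

end WickSystem

end NonHermitian

/-! ### Degrees of iterated derivatives and the effect of shifts on determinants -/

namespace NonHermitian

open Matrix

section MixedDeriv

variable {R ι : Type*} [AddCommGroup R] [Module ℂ R]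

theorem mixedDeriv_degree {d : ι → R →ₗ[ℂ] R} {E : R →ₗ[ℂ] R}
    (h : ∀ i g, E (d i g) = d i (E g) - d i g) {f : R} {m : ℂ} (hf : E f = m • f)
    (L₁ L₂ : List ι) :
    E (mixedDeriv d L₁ L₂ f) = (m - L₁.length - 2 * L₂.length) • mixedDeriv d L₁ L₂ f := by
  simp only [mixedDeriv, LinearMap.comp_apply]
  induction L₁ with
  | nil =>
    induction L₂ with
    | nil => simpa using hf
    | cons j L ih =>
      simp only [applyList_nil] at ih
      simp only [applyList_nil, applyList_cons, LinearMap.comp_apply, h, ih, map_smul, map_sub,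
        List.length_cons]
      push_cast
      module
  | cons j L ih =>
    rw [applyList_cons, h, ih, map_smul, List.length_cons]
    push_cast
    module

theorem mixedDeriv_eq_zero_of_mem {d : ι → R →ₗ[ℂ] R} (hd : ∀ i j g, d i (d j g) = d j (d i g))
    {e : R →ₗ[ℂ] R} (he : ∀ j g, e (d j g) = d j (e g)) {f : R} {j : ι} {L₁ L₂ : List ι}
    (hj : j ∈ L₂) (hf : e (d j (d j f)) = 0) : e (mixedDeriv d L₁ L₂ f) = 0 := by
  have key : ∀ L : List ι, j ∈ L → ∀ g, d j (d j g) = 0 →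
      applyList (fun i => d i ∘ₗ d i) L g = 0 := by
    intro L
    induction L with
    | nil => simp
    | cons k L ih =>
      intro hjk g hg
      rcases List.mem_cons.mp hjk with rfl | hmem
      · have h1 := map_applyList (d := fun i => d i ∘ₗ d i) (e := d j ∘ₗ d j)
          (fun i g => by simp [hd j i]) L g
        rw [applyList_cons, h1]
        simp [hg]
      · rw [applyList_cons, ih hmem g hg, map_zero]
  rw [map_mixedDeriv he]
  simp only [mixedDeriv, LinearMap.comp_apply]
  rw [key L₂ hj, map_zero]
  rw [← he, ← he, hf]

end MixedDeriv

namespace WickSystem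

variable {n R : Type*} [Fintype n] [DecidableEq n] [CommRing R] [Algebra ℂ R]
variable {S : WickSystem n R}

/-- `T z i` is the automorphism which shifts the matrix `X` to `X - z M i`. -/
structure IsShift {ι : Type*} (S : WickSystem n R) (M : ι → Matrix n n ℂ)
    (T : ℂ → ι → R →ₐ[ℂ] R) : Prop where
  map_D : ∀ z i k l f, T z i (S.D k l f) = S.D k l (T z i f)
  map_X : ∀ z i k l, T z i (S.X k l) = S.X k l - algebraMap ℂ R (z * M i k l)

theorem IsShift.map_rowOp {ι : Type*} {M : ι → Matrix n n ℂ} {T : ℂ → ι → R →ₐ[ℂ] R}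
    (hT : S.IsShift M T) {i : ι} {p : n} (hp : ∀ m, M i p m = 0) (z : ℂ) (q : n) (f : R) :
    T z i (S.rowOp p q f) = S.rowOp p q (T z i f) := by
  simp [rowOp_apply, hT.map_D, hT.map_X, hp]

theorem IsShift.map_det_single {M : n → Matrix n n ℂ} {T : ℂ → n → R →ₐ[ℂ] R}
    (hT : S.IsShift M T) (hM : ∀ i, M i = Matrix.single i i 1) (z : ℂ) (i : n) :
    T z i S.X.det = S.X.det - z • S.X.adjugate i i := by
  have h1 : (T z i).mapMatrix S.X =
      S.X.updateRow i (S.X i + (-algebraMap ℂ R z) • Pi.single i 1) := by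
    ext k l
    rw [AlgHom.mapMatrix_apply, map_apply, hT.map_X, hM, updateRow_apply]
    by_cases hk : k = i
    · subst hk
      by_cases hl : k = l
      · subst hl
        simp [sub_eq_add_neg, Algebra.algebraMap_eq_smul_one]
      · simp [hl, Ne.symm hl]
    · simp [hk, Matrix.single_apply_of_row_ne (Ne.symm hk)]
  rw [AlgHom.map_det, h1, det_updateRow_add, updateRow_eq_self, det_updateRow_smul,
    ← adjugate_apply, Algebra.smul_def]
  ring

/-- The shift changes rows `a` and `b` in one entry each, so by multilinearity the determinant is
quadratic in `z`. Because `D a b` is half of the derivative along the antisymmetric direction, the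
Taylor coefficients are `2 * z` and `2 * z ^ 2`. -/
theorem IsShift.map_det_antisymm [IsDomain R] {ι : Type*} {M : ι → Matrix n n ℂ}
    {T : ℂ → ι → R →ₐ[ℂ] R} (hT : S.IsShift M T) (hS : S.IsPaired (-1))
    (hn : Even (Fintype.card n)) {i : ι} {a b : n} (hab : a ≠ b)
    (hM : M i = Matrix.single a b 1 - Matrix.single b a 1) (z : ℂ) :
    T z i S.X.det = S.X.det - (2 * z) • S.D a b S.X.det
      + (2 * z ^ 2) • S.D a b (S.D a b S.X.det) := by
  have : CharZero R := charZero_of_injective_algebraMap (algebraMap ℂ R).injective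
  have ha := hS.adjugate_antisymm hn
  set ζ := algebraMap ℂ R z with hζ
  set Y := S.X.updateRow a (S.X a + (-ζ) • Pi.single b 1) with hY
  have h1 : (T z i).mapMatrix S.X = Y.updateRow b (Y b + ζ • Pi.single a 1) := by
    ext k l
    rw [AlgHom.mapMatrix_apply, map_apply, hT.map_X, hM, updateRow_apply]
    by_cases hk : k = b
    · subst hk
      by_cases hl : a = l
      · subst hl
        simp [hY, hab.symm, hζ, Algebra.algebraMap_eq_smul_one]
      · simp [hY, hab.symm, hl, hab, Ne.symm hl]
    · by_cases hka : k = a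
      · subst hka
        by_cases hl : b = l
        · subst hl
          simp [hY, updateRow_apply, hk, hab.symm, hζ, sub_eq_add_neg,
            Algebra.algebraMap_eq_smul_one]
        · simp [hY, updateRow_apply, hk, hl, hab.symm, Ne.symm hl]
      · simp [hY, updateRow_apply, hk, hka, Ne.symm hk, Ne.symm hka]
  set W := S.X.updateRow a (Pi.single b 1) with hW
  have h2 : (Y.updateRow b (Pi.single a 1)).det =
      S.X.adjugate a b - ζ * (W.updateRow b (Pi.single a 1)).det := by
    have e : ∀ x, (S.X.updateRow a x).updateRow b (Pi.single a 1) =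
        (S.X.updateRow b (Pi.single a 1)).updateRow a x := fun x =>
      Function.update_comm hab _ _ _
    have e2 : S.X a = S.X.updateRow b (Pi.single a 1) a := by rw [updateRow_ne hab]
    rw [hY, hW, e, e, det_updateRow_add, det_updateRow_smul]
    nth_rw 1 [e2]
    rw [updateRow_eq_self, ← adjugate_apply]
    ring
  -- This identifies the double minor with a second derivative: row `a` of `W` is constant, so only
  -- the entry `b a` of `W` contributes, with sign `-1`.
  have h3 : 2 * S.D a b (S.X.adjugate b a) = - (W.updateRow b (Pi.single a 1)).det := by
    rw [adjugate_apply, ← hW, derivation_det, Finset.mul_sum, ← adjugate_apply,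
      Finset.sum_eq_single b, Finset.mul_sum, Finset.sum_eq_single a]
    · rw [hW, updateRow_ne hab.symm, mul_left_comm, hS.D_X]
      simp [hab]
    · intro s _ hs
      rw [hW, updateRow_ne hab.symm, mul_left_comm, hS.D_X]
      simp [hab, hs.symm]
    · simp
    · intro r _ hr
      by_cases hra : r = a
      · subst hra
        have : ∀ s, S.D r b (W r s) = 0 := fun s => by
          rw [hW, updateRow_self, Pi.single_apply]
          split_ifs <;> simp
        simp [this]
      · rw [Finset.mul_sum]
        refine Finset.sum_eq_zero fun s _ => ?_
        rw [hW, updateRow_ne hra, mul_left_comm, hS.D_X]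
        simp [Ne.symm hra, Ne.symm hr]
    · simp
  rw [AlgHom.map_det, h1, det_updateRow_add, updateRow_eq_self, det_updateRow_smul, h2, hY,
    det_updateRow_add, updateRow_eq_self, det_updateRow_smul, ← adjugate_apply, hS.D_det ha,
    ha b a, Algebra.smul_def, Algebra.smul_def]
  simp only [map_mul, map_pow, ← hζ, map_ofNat]
  linear_combination (-ζ ^ 2) * h3

end WickSystem

end NonHermitian

/-! ### Shifted determinants in classes A and AI† -/

namespace NonHermitian

open Matrix

namespace WickSystem

variable {n R : Type*} [Fintype n] [DecidableEq n] [CommRing R] [Algebra ℂ R]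
variable {S : WickSystem n R}

theorem pairD_comm {ι : Type*} (a b : ι → n) (i j : ι) (g : R) :
    S.pairD a b i (S.pairD a b j g) = S.pairD a b j (S.pairD a b i g) := S.D_comm _ _ _ _ g

theorem D_mixedDeriv {ι : Type*} (a b : ι → n) (p q : n) (L₁ L₂ : List ι) (f : R) :
    S.D p q (mixedDeriv (S.pairD a b) L₁ L₂ f) = mixedDeriv (S.pairD a b) L₁ L₂ (S.D p q f) :=
  map_mixedDeriv (e := (S.D p q).toLinearMap) (fun _ _ => S.D_comm _ _ _ _ _) _ _ _

/-- Norms of the derivatives of the determinant when second derivatives vanish. -/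
theorem norm_eq_of_double_eq_zero {d : n → R →ₗ[ℂ] R} {f : R}
    (hd : ∀ i j g, d i (d j g) = d j (d i g)) (h0 : ∀ i, d i (d i f) = 0) {ν : ℕ → ℂ}
    (hν0 : S.B f f = ν 0)
    (hν : ∀ i (L : List n), (i :: L).Nodup →
      S.B (mixedDeriv d L [] f) (mixedDeriv d L [] f) = ν L.length →
      S.B (mixedDeriv d (i :: L) [] f) (mixedDeriv d (i :: L) [] f) = ν (L.length + 1))
    (L₁ L₂ : List n) (h : (L₁ ++ L₂).Nodup) :
    S.B (mixedDeriv d L₁ L₂ f) (mixedDeriv d L₁ L₂ f) =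
      if L₂.length = 0 then ν L₁.length else 0 := by
  cases L₂ with
  | cons i L₂ =>
    rw [mixedDeriv_cons_right hd, map_mixedDeriv (hd i), map_mixedDeriv (hd i), h0]
    simp
  | nil =>
    simp only [List.length_nil, if_true]
    rw [List.append_nil] at h
    induction L₁ with
    | nil => exact hν0
    | cons i L ih => exact hν i L h (ih h.of_cons)

/-- The determinant has degree one in each row, so `l = s = 1` in `form_shiftList` and double
derivatives vanish. After `b` derivatives `form_self` gives the ratio `N - b` of consecutive norms,
hence `(N - b)! / N!`. -/
theorem IsGinibre.form_shift [IsDomain R] (hS : S.IsGinibre) (h0 : S.X.det ≠ 0)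
    {T : ℂ → n → R →ₐ[ℂ] R}
    (hT : S.IsShift (fun i => Matrix.single i i 1) T) (z v : ℂ) :
    S.B (shiftList (fun i => (T z i).toLinearMap) Finset.univ.toList S.X.det)
        (shiftList (fun i => (T v i).toLinearMap) Finset.univ.toList S.X.det) =
      shiftSum (fun b c => if c = 0 then S.B S.X.det S.X.det *
        ((Fintype.card n - b).factorial / (Fintype.card n).factorial) else 0) (z * v)
        (Fintype.card n) 0 0 := by
  set d := S.pairD id id with hd
  have hE : ∀ i, S.rowOp i i S.X.det = S.X.det := fun i => by
    rw [rowOp_det _ _ _ fun m => hS.D_det i m, if_pos rfl]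
  have hE' : ∀ i, S.transpose.rowOp i i S.X.det = S.X.det := fun i => by
    have hdet : S.transpose.X.det = S.X.det := det_transpose _
    rw [← hdet, rowOp_det _ _ _ fun m => hS.transpose.D_det i m, if_pos rfl]
  have hEd : ∀ i j g, j ≠ i → S.rowOp i i (d j g) = d j (S.rowOp i i g) := fun i j g hj => by
    have := hS.D_rowOp j j i i g
    rw [if_neg hj, add_zero] at this
    exact this.symm
  have hEd' : ∀ i j g, j ≠ i → S.transpose.rowOp i i (d j g) = d j (S.transpose.rowOp i i g) :=
    fun i j g hj => by
      have := hS.transpose.D_rowOp j j i i g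
      rw [if_neg hj, add_zero] at this
      exact this.symm
  have hdd : ∀ i, d i (d i S.X.det) = 0 := fun i => by
    have : CharZero R := charZero_of_injective_algebraMap (algebraMap ℂ R).injective
    have h := hS.D_D_det h0 i i i i
    have h2 : 2 * S.D i i (S.D i i S.X.det) = 0 := by linear_combination h
    exact (mul_eq_zero.mp h2).resolve_left two_ne_zero
  have := form_shiftList S.B d (fun i => S.rowOp i i) (fun z i => (T z i).toLinearMap) S.X.det 1 1
    one_ne_zero (pairD_comm id id) (fun i => S.form_rowOp_comm i i) hEd
    (fun i g => by
      have := hS.D_rowOp i i i i g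
      rw [if_pos rfl] at this
      rw [one_smul, eq_sub_iff_add_eq]
      exact this.symm)
    (fun i => by rw [hE, one_smul])
    (fun z i j g => hT.map_D z i _ _ g)
    (fun z i j g hj => (hT.map_rowOp (i := j) (p := i)
      (fun m => Matrix.single_apply_of_row_ne hj _ _ _) z i g).symm)
    (fun z i => by
      have h := hT.map_det_single (fun _ => rfl) z i
      rw [← hS.D_det] at h
      rw [hdd, smul_zero, add_zero]
      exact h)
    (fun b c => if c = 0 then S.B S.X.det S.X.det *
      ((Fintype.card n - b).factorial / (Fintype.card n).factorial) else 0)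
    (norm_eq_of_double_eq_zero (pairD_comm id id) hdd
      (ν := fun b => S.B S.X.det S.X.det *
        ((Fintype.card n - b).factorial / (Fintype.card n).factorial))
      (by rw [Nat.sub_zero, div_self (by exact_mod_cast Nat.factorial_ne_zero _), mul_one])
      (fun i L hL ih => by
        have hi := (List.nodup_cons.mp hL).1
        have hlen : L.length + 1 ≤ Fintype.card n := hL.length_le_card
        have key := hS.form_self (g := mixedDeriv d L [] S.X.det) (i := i)
          -- The total degree that remains after differentiating along `i :: L`.
          (m := (Fintype.card n : ℂ) - L.length - 1)
          (by
            have := mixedDeriv_eigen (hEd i) (l := 1) (by rw [hE, one_smul]) hi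
              (List.not_mem_nil (a := i))
            rwa [one_smul] at this)
          (by
            have := mixedDeriv_eigen (hEd' i) (l := 1) (by rw [hE', one_smul]) hi
              (List.not_mem_nil (a := i))
            rwa [one_smul] at this)
          (fun j k => by
            rw [D_mixedDeriv, D_mixedDeriv, D_mixedDeriv, D_mixedDeriv, hS.D_D_det h0, map_neg])
          (by
            have := mixedDeriv_degree (d := d) (E := ∑ k, S.rowOp k k) (f := S.X.det)
              (m := Fintype.card n) (fun i g => by
                simp only [LinearMap.sum_apply]
                exact hS.degree_D i i g)
              (by simp [hE, Algebra.smul_def]) (i :: L) []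
            rw [mixedDeriv_cons_left, LinearMap.sum_apply] at this
            refine this.trans ?_
            congr 1
            simp
            ring)
        rw [mixedDeriv_cons_left]
        rw [ih] at key
        obtain ⟨p, hp⟩ := Nat.exists_eq_add_of_le hlen
        have e1 : Fintype.card n - L.length = p + 1 := by omega
        have e2 : Fintype.card n - (L.length + 1) = p := by omega
        have e3 : (Fintype.card n : ℂ) = L.length + 1 + p := by rw [hp]; push_cast; ring
        simp only [e1, Nat.factorial_succ] at key
        simp only [e2]
        have hp1 : (p : ℂ) + 1 ≠ 0 := by exact_mod_cast Nat.succ_ne_zero p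
        apply mul_left_cancel₀ hp1
        change _ * S.B (S.D i i (mixedDeriv d L [] S.X.det)) (S.D i i (mixedDeriv d L [] S.X.det)) = _
        rw [e3] at key
        push_cast at key
        linear_combination -key))
    z v Finset.univ.toList [] [] (by simpa using Finset.nodup_toList _)
  simpa [mixedDeriv] using this

/-- As for independent entries, but `form_self_symm` makes the ratio of consecutive norms `(N - b +
1) / 2`, whence the factors `2 ^ b` and the shifted factorials. -/
theorem IsPaired.form_shift_symm [IsDomain R] (hS : S.IsPaired 1) (h0 : S.X.det ≠ 0)
    {T : ℂ → n → R →ₐ[ℂ] R}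
    (hT : S.IsShift (fun i => Matrix.single i i 1) T) (z v : ℂ) :
    S.B (shiftList (fun i => (T z i).toLinearMap) Finset.univ.toList S.X.det)
        (shiftList (fun i => (T v i).toLinearMap) Finset.univ.toList S.X.det) =
      shiftSum (fun b c => if c = 0 then S.B S.X.det S.X.det *
        (2 ^ b * (Fintype.card n - b + 1).factorial / (Fintype.card n + 1).factorial) else 0) (z * v)
        (Fintype.card n) 0 0 := by
  set d := S.pairD id id with hd
  have : CharZero R := charZero_of_injective_algebraMap (algebraMap ℂ R).injective
  have hE : ∀ i, S.rowOp i i S.X.det = S.X.det := fun i => by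
    rw [rowOp_det _ _ _ fun m => hS.D_det hS.adjugate_symm i m, if_pos rfl]
  have hEd : ∀ i j g, j ≠ i → S.rowOp i i (d j g) = d j (S.rowOp i i g) := fun i j g hj => by
    have := hS.two_mul_D_rowOp j j i i g
    rw [if_neg hj, mul_zero, add_zero, add_zero] at this
    exact (mul_left_cancel₀ two_ne_zero this).symm
  have hdd : ∀ i, d i (d i S.X.det) = 0 := fun i => by
    have h := hS.two_mul_D_D_det h0 i i i
    have h2 : 3 * S.D i i (S.D i i S.X.det) = 0 := by linear_combination h
    exact (mul_eq_zero.mp h2).resolve_left (by norm_num)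
  have := form_shiftList S.B d (fun i => S.rowOp i i) (fun z i => (T z i).toLinearMap) S.X.det 1 1
    one_ne_zero (pairD_comm id id) (fun i => S.form_rowOp_comm i i) hEd
    (fun i g => by
      have := hS.two_mul_D_rowOp i i i i g
      rw [if_pos rfl] at this
      rw [one_smul, eq_sub_iff_add_eq]
      refine mul_left_cancel₀ (two_ne_zero' R) ?_
      change 2 * (S.rowOp i i (S.D i i g) + S.D i i g) = 2 * S.D i i (S.rowOp i i g)
      linear_combination -this)
    (fun i => by rw [hE, one_smul])
    (fun z i j g => hT.map_D z i _ _ g)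
    (fun z i j g hj => (hT.map_rowOp (i := j) (p := i)
      (fun m => Matrix.single_apply_of_row_ne hj _ _ _) z i g).symm)
    (fun z i => by
      have h := hT.map_det_single (fun _ => rfl) z i
      rw [← hS.D_det hS.adjugate_symm] at h
      rw [hdd, smul_zero, add_zero]
      exact h)
    (fun b c => if c = 0 then S.B S.X.det S.X.det *
      (2 ^ b * (Fintype.card n - b + 1).factorial / (Fintype.card n + 1).factorial) else 0)
    (norm_eq_of_double_eq_zero (pairD_comm id id) hdd
      (ν := fun b => S.B S.X.det S.X.det *
        (2 ^ b * (Fintype.card n - b + 1).factorial / (Fintype.card n + 1).factorial))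
      (by rw [Nat.sub_zero, pow_zero, one_mul,
        div_self (by exact_mod_cast Nat.factorial_ne_zero _), mul_one])
      (fun i L hL ih => by
        have hi := (List.nodup_cons.mp hL).1
        have hlen : L.length + 1 ≤ Fintype.card n := hL.length_le_card
        have key := hS.form_self_symm (g := mixedDeriv d L [] S.X.det) (i := i)
          (m := (Fintype.card n : ℂ) - L.length - 1)
          (by
            have := mixedDeriv_eigen (hEd i) (l := 1) (by rw [hE, one_smul]) hi
              (List.not_mem_nil (a := i))
            rwa [one_smul] at this)
          (fun j k => by
            have h := congrArg (mixedDeriv d L []) (hS.two_mul_D_D_det h0 i j k)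
            rw [S.D_comm i i j k, two_mul, map_add, map_neg] at h
            rw [D_mixedDeriv, D_mixedDeriv, D_mixedDeriv, D_mixedDeriv, two_mul, h])
          (by
            have := mixedDeriv_degree (d := d) (E := ∑ k, S.rowOp k k) (f := S.X.det)
              (m := Fintype.card n) (fun i g => by
                simp only [LinearMap.sum_apply]
                exact hS.degree_D i i g)
              (by simp [hE, Algebra.smul_def]) (i :: L) []
            rw [mixedDeriv_cons_left, LinearMap.sum_apply] at this
            refine this.trans ?_
            congr 1
            simp
            ring)
        rw [mixedDeriv_cons_left]
        rw [ih] at key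
        obtain ⟨p, hp⟩ := Nat.exists_eq_add_of_le hlen
        have e1 : Fintype.card n - L.length = p + 1 := by omega
        have e2 : Fintype.card n - (L.length + 1) = p := by omega
        have e3 : (Fintype.card n : ℂ) = L.length + 1 + p := by rw [hp]; push_cast; ring
        simp only [e1, Nat.factorial_succ] at key
        simp only [e2]
        have hp1 : (p : ℂ) + 1 + 1 ≠ 0 := by exact_mod_cast Nat.succ_ne_zero (p + 1)
        apply mul_left_cancel₀ hp1
        change _ * S.B (S.D i i (mixedDeriv d L [] S.X.det)) (S.D i i (mixedDeriv d L [] S.X.det)) = _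
        rw [e3] at key
        simp only [Nat.factorial_succ]
        push_cast at key ⊢
        linear_combination -2 * key))
    z v Finset.univ.toList [] [] (by simpa using Finset.nodup_toList _)
  simpa [mixedDeriv] using this

end WickSystem

end NonHermitian

/-! ### Shifted determinants in class AII†: antisymmetric matrices of size `2N` -/

namespace NonHermitian

open Matrix

namespace WickSystem

variable {ι R : Type*} [Fintype ι] [DecidableEq ι] [CommRing R] [Algebra ℂ R]
variable {S : WickSystem (ι ⊕ ι) R}

/-- Differentiation with respect to the entry at the symplectic partners `inl i`, `inr i`. -/
noncomputable def partnerD (S : WickSystem (ι ⊕ ι) R) (i : ι) : R →ₗ[ℂ] R :=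
  (2 : ℂ) • (S.D (Sum.inl i) (Sum.inr i)).toLinearMap

theorem partnerD_apply (i : ι) (f : R) :
    S.partnerD i f = (2 : ℂ) • S.D (Sum.inl i) (Sum.inr i) f := rfl

theorem D_partnerD (p q : ι ⊕ ι) (j : ι) (f : R) :
    S.D p q (S.partnerD j f) = S.partnerD j (S.D p q f) := by
  rw [partnerD_apply, partnerD_apply, Derivation.map_smul, S.D_comm]

theorem partnerD_comm (i j : ι) (f : R) :
    S.partnerD i (S.partnerD j f) = S.partnerD j (S.partnerD i f) := by
  rw [partnerD_apply i, D_partnerD, partnerD_apply i, map_smul]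

theorem D_mixedDeriv_partnerD (p q : ι ⊕ ι) (L₁ L₂ : List ι) (f : R) :
    S.D p q (mixedDeriv S.partnerD L₁ L₂ f) = mixedDeriv S.partnerD L₁ L₂ (S.D p q f) :=
  map_mixedDeriv (e := (S.D p q).toLinearMap) (fun j g => D_partnerD p q j g) _ _ _

theorem smul_D_D (i : ι) (g : R) :
    S.partnerD i (S.partnerD i g) =
      (4 : ℂ) • S.D (Sum.inl i) (Sum.inr i) (S.D (Sum.inl i) (Sum.inr i) g) := by
  rw [partnerD_apply, partnerD_apply, Derivation.map_smul, smul_smul]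
  norm_num

namespace IsPaired

variable [IsDomain R]

theorem rowOp_partnerD (hS : S.IsPaired (-1)) {i j : ι} (hj : j ≠ i) {p : ι ⊕ ι}
    (hp : p = Sum.inl i ∨ p = Sum.inr i) (q : ι ⊕ ι) (g : R) :
    S.rowOp p q (S.partnerD j g) = S.partnerD j (S.rowOp p q g) := by
  have : CharZero R := charZero_of_injective_algebraMap (algebraMap ℂ R).injective
  have h := hS.two_mul_D_rowOp (Sum.inl j) (Sum.inr j) p q g
  have h1 : Sum.inl j ≠ p := by rcases hp with rfl | rfl <;> simp [hj]
  have h2 : Sum.inr j ≠ p := by rcases hp with rfl | rfl <;> simp [hj]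
  rw [if_neg h1, if_neg h2, mul_zero, add_zero, add_zero] at h
  rw [partnerD_apply, partnerD_apply, map_smul, mul_left_cancel₀ two_ne_zero h]

theorem rowOp_det_antisymm (hS : S.IsPaired (-1)) (p q : ι ⊕ ι) :
    S.rowOp p q S.X.det = if p = q then S.X.det else 0 :=
  rowOp_det _ _ _ fun m => hS.D_det (hS.adjugate_antisymm (by simp)) q m

theorem rowOp_mixedDeriv (hS : S.IsPaired (-1)) {i : ι} {p : ι ⊕ ι}
    (hp : p = Sum.inl i ∨ p = Sum.inr i) (q : ι ⊕ ι) {L₁ L₂ : List ι} (h₁ : i ∉ L₁)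
    (h₂ : i ∉ L₂) :
    S.rowOp p q (mixedDeriv S.partnerD L₁ L₂ S.X.det) =
      if p = q then mixedDeriv S.partnerD L₁ L₂ S.X.det else 0 := by
  have h := mixedDeriv_eigen (E := S.rowOp p q) (d := S.partnerD) (f := S.X.det)
    (l := if p = q then 1 else 0)
    (fun j g hj => hS.rowOp_partnerD hj hp q g)
    (by rw [hS.rowOp_det_antisymm]; split_ifs <;> simp) h₁ h₂
  rw [h]
  split_ifs <;> simp

theorem degree_mixedDeriv (hS : S.IsPaired (-1)) (L₁ L₂ : List ι) :
    (∑ k, S.rowOp k k (mixedDeriv S.partnerD L₁ L₂ S.X.det)) =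
      (2 * Fintype.card ι - L₁.length - 2 * L₂.length : ℂ) •
        mixedDeriv S.partnerD L₁ L₂ S.X.det := by
  have := mixedDeriv_degree (d := S.partnerD) (E := ∑ k, S.rowOp k k) (f := S.X.det)
    (m := 2 * Fintype.card ι)
    (fun i g => by
      simp only [LinearMap.sum_apply, partnerD_apply, map_smul]
      rw [← smul_sub, hS.degree_D])
    (by
      simp only [LinearMap.sum_apply, hS.rowOp_det_antisymm, if_true, Finset.sum_const,
        Finset.card_univ, Fintype.card_sum]
      rw [← Nat.cast_smul_eq_nsmul ℂ]
      congr 1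
      push_cast
      ring) L₁ L₂
  rwa [LinearMap.sum_apply] at this

theorem two_mul_D_D_D_mixedDeriv (hS : S.IsPaired (-1)) (h0 : S.X.det ≠ 0) (a b i j : ι ⊕ ι)
    (L₁ L₂ : List ι) :
    2 * S.D a i (S.D b j (S.D a b (mixedDeriv S.partnerD L₁ L₂ S.X.det))) =
      - S.D i j (S.D a b (S.D a b (mixedDeriv S.partnerD L₁ L₂ S.X.det))) := by
  have h := congrArg (mixedDeriv S.partnerD L₁ L₂)
    (hS.two_mul_D_D_D_det (by simp) h0 a b i j)
  rw [two_mul, map_add, map_neg, ← two_mul] at h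
  simpa only [D_mixedDeriv_partnerD] using h

/-- A simple derivative is traded for a double one by `form_D_antisymm`, where `2 + m` is the degree
before the two derivatives along `i`. As `partnerD` is `2 • D`, the two sides carry factors 4 and
16, which leaves the quarter. -/
theorem norm_cons_left (hS : S.IsPaired (-1)) (h0 : S.X.det ≠ 0) {i : ι} {L₁ L₂ : List ι}
    (h₁ : i ∉ L₁) (h₂ : i ∉ L₂) :
    S.B (mixedDeriv S.partnerD (i :: L₁) L₂ S.X.det) (mixedDeriv S.partnerD (i :: L₁) L₂ S.X.det) =
      (2 * Fintype.card ι - L₁.length - 2 * L₂.length) / 4 *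
        S.B (mixedDeriv S.partnerD L₁ (i :: L₂) S.X.det)
          (mixedDeriv S.partnerD L₁ (i :: L₂) S.X.det) := by
  have hdeg := hS.degree_mixedDeriv L₁ (i :: L₂)
  rw [mixedDeriv_cons_left, mixedDeriv_cons_right partnerD_comm, smul_D_D, partnerD_apply]
  rw [mixedDeriv_cons_right partnerD_comm, smul_D_D, smul_comm] at hdeg
  simp only [map_smul, ← Finset.smul_sum] at hdeg
  have := hS.form_D_antisymm (a := Sum.inl i) (b := Sum.inr i) (by simp)
    (by simpa using hS.rowOp_mixedDeriv (Or.inl rfl) (Sum.inl i) h₁ h₂)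
    (by simpa using hS.rowOp_mixedDeriv (Or.inr rfl) (Sum.inr i) h₁ h₂)
    (fun j k => hS.two_mul_D_D_D_mixedDeriv h0 _ _ j k L₁ L₂)
    (smul_right_injective R (by norm_num : (4 : ℂ) ≠ 0) hdeg)
  simp only [map_smul, LinearMap.smul_apply, smul_eq_mul, this, List.length_cons]
  push_cast
  ring

/-- A double derivative along the pair `j` exhausts the dependence on the rows `inl j` and `inr j`.
-/
theorem D_eq_zero_of_mem (hS : S.IsPaired (-1)) (h0 : S.X.det ≠ 0) {j : ι} {L₁ L₂ : List ι}
    (hj : j ∈ L₂) (m : ι ⊕ ι) {k : ι ⊕ ι} (hk : k = Sum.inl j ∨ k = Sum.inr j) :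
    S.D m k (mixedDeriv S.partnerD L₁ L₂ S.X.det) = 0 := by
  refine mixedDeriv_eq_zero_of_mem (e := (S.D m k).toLinearMap) partnerD_comm
    (fun j g => D_partnerD m k j g) hj ?_
  change S.D m k _ = 0
  rw [smul_D_D, Derivation.map_smul, hS.D_swap k m]
  rcases hk with rfl | rfl
  · have h := D_D_D_eq_zero (fun p q => hS.two_mul_D_D_D_det (by simp) h0 (Sum.inr j)
      (Sum.inl j) p q) m
    have e : ∀ f, S.D (Sum.inr j) (Sum.inl j) f = - S.D (Sum.inl j) (Sum.inr j) f := fun f => by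
      rw [hS.D_swap, neg_one_mul]
    simp only [e, map_neg, neg_neg] at h
    simp [h]
  · have h := D_D_D_eq_zero (fun p q => hS.two_mul_D_D_D_det (by simp) h0 (Sum.inl j)
      (Sum.inr j) p q) m
    simp [h]

/-- Expand along the row `inl i`. Entries leading to pairs in `L` contribute nothing, and the other
`2 * (N - L.length) - 1` off-diagonal ones all contribute the same `V` by `form_D_eq`. Finally
`norm_cons_left` expresses `V` through the double derivative. -/
theorem norm_cons_right (hS : S.IsPaired (-1)) (h0 : S.X.det ≠ 0) {i : ι} {L : List ι}
    (hL : (i :: L).Nodup) :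
    S.B (mixedDeriv S.partnerD [] L S.X.det) (mixedDeriv S.partnerD [] L S.X.det) =
      (2 * (Fintype.card ι - L.length) - 1) * (2 * (Fintype.card ι - L.length)) / 16 *
        S.B (mixedDeriv S.partnerD [] (i :: L) S.X.det)
          (mixedDeriv S.partnerD [] (i :: L) S.X.det) := by
  have hi : i ∉ L := (List.nodup_cons.mp hL).1
  set g := mixedDeriv S.partnerD [] L S.X.det with hg
  have h1 := hS.norm_cons_left h0 (List.not_mem_nil (a := i)) hi
  set V := S.B (S.D (Sum.inl i) (Sum.inr i) g) (S.D (Sum.inl i) (Sum.inr i) g) with hV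
  have h2 : S.B (mixedDeriv S.partnerD [i] L S.X.det) (mixedDeriv S.partnerD [i] L S.X.det) =
      4 * V := by
    rw [mixedDeriv_cons_left, partnerD_apply]
    simp only [map_smul, LinearMap.smul_apply, smul_eq_mul, hV, hg]
    ring
  have hrow : S.rowOp (Sum.inl i) (Sum.inl i) g = g := by
    simpa using hS.rowOp_mixedDeriv (Or.inl rfl) (Sum.inl i) List.not_mem_nil hi
  have halive : ∀ k j, j ∉ L → (k = Sum.inl j ∨ k = Sum.inr j) → k ≠ Sum.inl i →
      S.B (S.D (Sum.inl i) k g) (S.D (Sum.inl i) k g) = V := by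
    intro k j hj hk hki
    by_cases hkb : k = Sum.inr i
    · rw [hkb]
    · exact hS.form_D_eq (by simp) hki.symm
        (by simpa [Ne.symm hkb] using
          hS.rowOp_mixedDeriv (Or.inr rfl) k (List.not_mem_nil (a := i)) hi)
        (by simpa [hkb] using
          hS.rowOp_mixedDeriv hk (Sum.inr i) (List.not_mem_nil (a := j)) hj)
  have hsum : S.B g g = ∑ k, S.B (S.D (Sum.inl i) k g) (S.D (Sum.inl i) k g) := by
    rw [← S.form_rowOp, hrow]
  have hterm : ∀ j, S.B (S.D (Sum.inl i) (Sum.inl j) g) (S.D (Sum.inl i) (Sum.inl j) g)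
      + S.B (S.D (Sum.inl i) (Sum.inr j) g) (S.D (Sum.inl i) (Sum.inr j) g) =
      (if j ∉ L.toFinset then 2 * V else 0) - (if j = i then V else 0) := by
    intro j
    by_cases hj : j ∈ L
    · have hji : j ≠ i := fun h => hi (h ▸ hj)
      rw [hS.D_eq_zero_of_mem h0 hj _ (Or.inl rfl), hS.D_eq_zero_of_mem h0 hj _ (Or.inr rfl)]
      simp [hj, hji]
    · rw [halive _ j hj (Or.inr rfl) (by simp)]
      by_cases hji : j = i
      · subst hji
        rw [hS.D_self_eq_zero]
        simp [hj]
        ring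
      · rw [halive _ j hj (Or.inl rfl) (by simpa using hji)]
        simp [hj, hji]
        ring
  rw [Fintype.sum_sum_type, ← Finset.sum_add_distrib, Finset.sum_congr rfl fun j _ => hterm j,
    Finset.sum_sub_distrib, Finset.sum_ite_eq' Finset.univ i, if_pos (Finset.mem_univ i),
    ← Finset.sum_filter, Finset.sum_const] at hsum
  have hcard : ((Finset.univ.filter fun j => j ∉ L.toFinset).card : ℂ) =
      Fintype.card ι - L.length := by
    have e : (Finset.univ.filter fun j => j ∉ L.toFinset) = L.toFinsetᶜ := by
      ext j; simp
    rw [e, Finset.card_compl, List.toFinset_card_of_nodup hL.of_cons,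
      Nat.cast_sub hL.of_cons.length_le_card]
  rw [nsmul_eq_mul, hcard] at hsum
  rw [h2] at h1
  simp only [List.length_nil, Nat.cast_zero, sub_zero] at h1
  rw [hsum]
  linear_combination (2 * ((Fintype.card ι : ℂ) - L.length) - 1) / 4 * h1

/-- The squared norms of the mixed derivatives of a self-dual determinant, relative to the norm of
the determinant itself. -/
noncomputable def _root_.NonHermitian.selfDualNorm (N b c : ℕ) : ℂ :=
  4 ^ (b + 2 * c) * (2 * (N - b - c) + b + 1).factorial /
    ((2 * (N - b - c) + 1 : ℕ) * (2 * N).factorial)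

/-- The two recursions determine all norms: `norm_cons_left` turns simple derivatives into double
ones, and `norm_cons_right` removes the double derivatives when no simple ones are left. -/
theorem norm_mixedDeriv (hS : S.IsPaired (-1)) (h0 : S.X.det ≠ 0) (L₁ L₂ : List ι)
    (h : (L₁ ++ L₂).Nodup) :
    S.B (mixedDeriv S.partnerD L₁ L₂ S.X.det) (mixedDeriv S.partnerD L₁ L₂ S.X.det) =
      S.B S.X.det S.X.det * selfDualNorm (Fintype.card ι) L₁.length L₂.length := by
  induction L₁ generalizing L₂ with
  | nil =>
    rw [List.nil_append] at h
    induction L₂ with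
    | nil =>
      have h1 : ((2 * Fintype.card ι).factorial : ℂ) ≠ 0 := by
        exact_mod_cast Nat.factorial_ne_zero _
      have h2 : ((2 * Fintype.card ι + 1 : ℕ) : ℂ) ≠ 0 := Nat.cast_ne_zero.mpr (by omega)
      have h3 : selfDualNorm (Fintype.card ι) 0 0 = 1 := by
        simp only [selfDualNorm, Nat.sub_zero, mul_zero, add_zero, pow_zero, one_mul,
          Nat.factorial_succ]
        push_cast at h2 ⊢
        field_simp
      simp [mixedDeriv, h3]
    | cons i L ih =>
      have ih := ih h.of_cons
      have hlen : L.length + 1 ≤ Fintype.card ι := h.length_le_card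
      rw [hS.norm_cons_right h0 h] at ih
      obtain ⟨p, hp⟩ := Nat.exists_eq_add_of_le hlen
      have hc : (Fintype.card ι : ℂ) = L.length + 1 + p := by rw [hp]; push_cast; ring
      rw [hc] at ih
      have e1 : 2 * (Fintype.card ι - 0 - L.length) + 0 + 1 = 2 * p + 1 + 1 + 1 := by omega
      have e2 : 2 * (Fintype.card ι - 0 - (L.length + 1)) + 0 + 1 = 2 * p + 1 := by omega
      simp only [selfDualNorm, List.length_nil, List.length_cons, e1, e2,
        Nat.factorial_succ] at ih ⊢
      have h1 : ((2 * Fintype.card ι).factorial : ℂ) ≠ 0 := by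
        exact_mod_cast Nat.factorial_ne_zero _
      have h2 : ((2 * p + 1 : ℕ) : ℂ) ≠ 0 := Nat.cast_ne_zero.mpr (by omega)
      have h3 : ((2 * p + 1 + 1 : ℕ) : ℂ) ≠ 0 := Nat.cast_ne_zero.mpr (by omega)
      have h4 : ((2 * p + 1 + 1 + 1 : ℕ) : ℂ) ≠ 0 := Nat.cast_ne_zero.mpr (by omega)
      have h5 : ((2 * p + 1 : ℕ) : ℂ) * (2 * p + 1 + 1 : ℕ) / 16 ≠ 0 := by
        simp only [ne_eq, div_eq_zero_iff, mul_eq_zero, h2, h3]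
        norm_num
      apply mul_left_cancel₀ h5
      have e3 : (2 * ((L.length : ℂ) + 1 + p - L.length) - 1) *
          (2 * ((L.length : ℂ) + 1 + p - L.length)) / 16 =
          ((2 * p + 1 : ℕ) : ℂ) * (2 * p + 1 + 1 : ℕ) / 16 := by push_cast; ring
      rw [e3] at ih
      refine (by rw [mul_div_assoc] : _ = _).trans (ih.trans ?_)
      have e4 : (4 : ℂ) ^ (0 + 2 * (L.length + 1)) = 16 * 4 ^ (0 + 2 * L.length) := by
        rw [show 0 + 2 * (L.length + 1) = (0 + 2 * L.length) + 2 by ring, pow_add]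
        norm_num
        ring
      rw [e4]
      simp only [Nat.cast_mul] at *
      field_simp
  | cons i L ih =>
    have hnd := h
    simp only [List.cons_append, List.nodup_cons, List.mem_append, not_or] at h
    obtain ⟨⟨hi₁, hi₂⟩, h⟩ := h
    have hlen := hnd.length_le_card
    simp only [List.length_append, List.length_cons] at hlen
    rw [hS.norm_cons_left h0 hi₁ hi₂, ih (i :: L₂) (hnd.perm (by simpa using
      List.perm_middle.symm))]
    obtain ⟨p, hp⟩ := Nat.exists_eq_add_of_le hlen
    have hc : (Fintype.card ι : ℂ) = L.length + L₂.length + 1 + p := by rw [hp]; push_cast; ring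
    have e1 : Fintype.card ι - L.length - (L₂.length + 1) = p := by omega
    have e2 : Fintype.card ι - (L.length + 1) - L₂.length = p := by omega
    have e3 : 2 * p + (L.length + 1) + 1 = (2 * p + L.length + 1) + 1 := by ring
    have e4 : (4 : ℂ) ^ (L.length + 2 * (L₂.length + 1)) =
        4 * 4 ^ (L.length + 1 + 2 * L₂.length) := by
      rw [← pow_succ']
      congr 1
      ring
    simp only [selfDualNorm, List.length_cons, e1, e2, e3, e4, Nat.factorial_succ]
    rw [hc]
    push_cast
    ring

theorem form_shift_antisymm (hS : S.IsPaired (-1)) (h0 : S.X.det ≠ 0) {T : ℂ → ι → R →ₐ[ℂ] R}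
    (hT : S.IsShift (fun i => Matrix.single (Sum.inl i) (Sum.inr i) 1
      - Matrix.single (Sum.inr i) (Sum.inl i) 1) T) (z v : ℂ) :
    S.B (shiftList (fun i => (T z i).toLinearMap) Finset.univ.toList S.X.det)
        (shiftList (fun i => (T v i).toLinearMap) Finset.univ.toList S.X.det) =
      shiftSum (fun b c => S.B S.X.det S.X.det * selfDualNorm (Fintype.card ι) b c) (z * v)
        (Fintype.card ι) 0 0 := by
  have : CharZero R := charZero_of_injective_algebraMap (algebraMap ℂ R).injective
  -- Doubling the row operator offsets the half weight of an entry in a row: each derivative lowers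
  -- the eigenvalue by one, starting from 2.
  have := form_shiftList S.B S.partnerD (fun i => (2 : ℂ) • S.rowOp (Sum.inl i) (Sum.inl i))
    (fun z i => (T z i).toLinearMap) S.X.det 2 1
    one_ne_zero partnerD_comm
    (fun i f g => by simp [S.form_rowOp_comm (Sum.inl i) (Sum.inl i)])
    (fun i j g hj => by
      simp only [LinearMap.smul_apply, map_smul]
      rw [hS.rowOp_partnerD hj (Or.inl rfl)])
    (fun i g => by
      have h := hS.two_mul_D_rowOp (Sum.inl i) (Sum.inr i) (Sum.inl i) (Sum.inl i) g
      rw [if_pos rfl, if_neg (by simp), mul_zero, add_zero] at h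
      simp only [LinearMap.smul_apply, partnerD_apply, map_smul]
      simp only [two_smul, one_smul]
      linear_combination -2 * h)
    (fun i => by
      rw [LinearMap.smul_apply, hS.rowOp_det_antisymm, if_pos rfl])
    (fun z i j g => by
      simp only [partnerD_apply, map_smul, AlgHom.toLinearMap_apply, hT.map_D])
    (fun z i j g hj => by
      simp only [LinearMap.smul_apply, map_smul, AlgHom.toLinearMap_apply]
      rw [hT.map_rowOp (i := j) (p := Sum.inl i) (fun m => by
        simp [hj])])
    (fun z i => by
      rw [smul_D_D, partnerD_apply, smul_smul, smul_smul, show z * 2 = 2 * z by ring,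
        show z ^ 2 / 2 * 4 = 2 * z ^ 2 by ring]
      exact hT.map_det_antisymm hS (by simp) (by simp) rfl z)
    (fun b c => S.B S.X.det S.X.det * selfDualNorm (Fintype.card ι) b c)
    (hS.norm_mixedDeriv h0)
    z v Finset.univ.toList [] [] (by simpa using Finset.nodup_toList _)
  simpa [mixedDeriv] using this

end IsPaired

end WickSystem

end NonHermitian

/-! ### The form on polynomials and matrices of variables -/

namespace NonHermitian

open MvPolynomial

section FockForm

variable {σ : Type*} [Fintype σ]

/-- The squared norm of the monomial with exponents `a`. -/
noncomputable def fockWeight (v : σ → ℂ) (a : σ →₀ ℕ) : ℂ :=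
  ∏ k, ((a k).factorial : ℂ) * v k ^ a k

/-- The bilinear form on polynomials in which monomials are orthogonal, with the moments of
independent complex Gaussian variables of variances `v`. -/
noncomputable def fockForm (v : σ → ℂ) :
    MvPolynomial σ ℂ →ₗ[ℂ] MvPolynomial σ ℂ →ₗ[ℂ] ℂ :=
  (basisMonomials σ ℂ).constr ℂ fun a => fockWeight v a • lcoeff ℂ a

theorem fockForm_monomial (v : σ → ℂ) (a : σ →₀ ℕ) (c : ℂ) (g : MvPolynomial σ ℂ) :
    fockForm v (monomial a c) g = c * (fockWeight v a * coeff a g) := by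
  have h : monomial a c = c • basisMonomials σ ℂ a := by
    rw [coe_basisMonomials, smul_monomial, smul_eq_mul, mul_one]
  rw [h, map_smul, fockForm, Module.Basis.constr_basis]
  simp [lcoeff]

theorem fockForm_monomial_monomial [DecidableEq σ] (v : σ → ℂ) (a b : σ →₀ ℕ) (c c' : ℂ) :
    fockForm v (monomial a c) (monomial b c') =
      c * c' * ∏ k, if a k = b k then ((a k).factorial : ℂ) * v k ^ a k else 0 := by
  rw [fockForm_monomial, coeff_monomial]
  by_cases h : b = a
  · subst h
    simp [fockWeight]
    ring
  · rw [if_neg h, mul_zero, mul_zero]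
    obtain ⟨k, hk⟩ : ∃ k, a k ≠ b k := by
      by_contra hcon
      push Not at hcon
      exact h (Finsupp.ext fun k => (hcon k).symm)
    rw [Finset.prod_eq_zero (Finset.mem_univ k) (if_neg hk), mul_zero]

theorem fockForm_comm (v : σ → ℂ) (f g : MvPolynomial σ ℂ) :
    fockForm v f g = fockForm v g f := by
  classical
  induction f using MvPolynomial.induction_on' with
  | monomial a c =>
    induction g using MvPolynomial.induction_on' with
    | monomial b c' =>
      rw [fockForm_monomial_monomial, fockForm_monomial_monomial, mul_comm c]
      congr 1
      refine Finset.prod_congr rfl fun k _ => ?_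
      by_cases h : a k = b k
      · rw [if_pos h, if_pos h.symm, h]
      · rw [if_neg h, if_neg (Ne.symm h)]
    | add p q hp hq => simp [hp, hq]
  | add p q hp hq => simp [hp, hq]

theorem fockWeight_add_single [DecidableEq σ] (v : σ → ℂ) (a : σ →₀ ℕ) (k : σ) :
    fockWeight v (a + Finsupp.single k 1) = v k * (a k + 1) * fockWeight v a := by
  unfold fockWeight
  rw [← Finset.mul_prod_erase _ _ (Finset.mem_univ k),
    ← Finset.mul_prod_erase _ (fun k => ((a k).factorial : ℂ) * v k ^ a k) (Finset.mem_univ k)]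
  have h : ∀ j ∈ Finset.univ.erase k,
      (((a + Finsupp.single k 1 : σ →₀ ℕ) j).factorial : ℂ) *
          v j ^ (a + Finsupp.single k 1 : σ →₀ ℕ) j =
        ((a j).factorial : ℂ) * v j ^ a j := fun j hj => by
    simp [(Finset.ne_of_mem_erase hj).symm]
  rw [Finset.prod_congr rfl h]
  simp only [Finsupp.add_apply, Finsupp.single_eq_same, Nat.factorial_succ, pow_succ]
  push_cast
  ring

/-- On monomials, both sides compare the weight of `a + single k 1` with that of `a`, whose ratio `v
k * (a k + 1)` is the variance times the factor produced by the derivative. -/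
theorem fockForm_X_mul (v : σ → ℂ) (k : σ) (f g : MvPolynomial σ ℂ) :
    fockForm v (X k * f) g = v k * fockForm v f (pderiv k g) := by
  classical
  induction f using MvPolynomial.induction_on' with
  | monomial a c =>
    rw [X, monomial_mul, one_mul, fockForm_monomial, fockForm_monomial, coeff_pderiv, add_comm,
      fockWeight_add_single]
    ring
  | add p q hp hq => simp [mul_add, hp, hq]

end FockForm

theorem pderiv_comm {σ : Type*} (i j : σ) (f : MvPolynomial σ ℂ) :
    pderiv i (pderiv j f) = pderiv j (pderiv i f) := by
  classical
  ext m
  simp only [coeff_pderiv]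
  by_cases h : i = j
  · subst h; rfl
  · rw [add_right_comm]
    simp [h, Ne.symm h]
    ring

section EntrySystem

variable {σ n : Type*} [Fintype σ] [Fintype n] [DecidableEq n]

/-- The Wick system of a matrix whose entry at `i j` is `s i j` times the variable `idx i j`. -/
noncomputable def entrySystem (v : σ → ℂ) (s : n → n → ℂ) (idx : n → n → σ) :
    WickSystem n (MvPolynomial σ ℂ) where
  X := Matrix.of fun i j => C (s i j) * X (idx i j)
  D i j := (v (idx i j) * s i j) • pderiv (idx i j)
  B := fockForm v
  D_comm i j k l f := by
    simp only [Derivation.smul_apply, Derivation.map_smul]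
    rw [pderiv_comm, smul_comm]
  B_symm := fockForm_comm v
  wick i j f g := by
    rw [Matrix.of_apply, mul_assoc, ← smul_eq_C_mul]
    simp [fockForm_X_mul]
    ring

theorem entrySystem_X (v : σ → ℂ) (s : n → n → ℂ) (idx : n → n → σ) (i j : n) :
    (entrySystem v s idx).X i j = C (s i j) * X (idx i j) := rfl

theorem entrySystem_D (v : σ → ℂ) (s : n → n → ℂ) (idx : n → n → σ) (i j : n)
    (f : MvPolynomial σ ℂ) :
    (entrySystem v s idx).D i j f = (v (idx i j) * s i j) • pderiv (idx i j) f := rfl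

theorem entrySystem_D_X [DecidableEq σ] (v : σ → ℂ) (s : n → n → ℂ) (idx : n → n → σ)
    (i j k l : n) :
    (entrySystem v s idx).D i j ((entrySystem v s idx).X k l) =
      C (if idx i j = idx k l then v (idx i j) * s i j * s k l else 0) := by
  rw [entrySystem_X, entrySystem_D, pderiv_C_mul, pderiv_X]
  by_cases h : idx i j = idx k l
  · rw [h, Pi.single_eq_same, if_pos rfl, smul_eq_C_mul, mul_one, ← map_mul]
  · rw [Pi.single_eq_of_ne (Ne.symm h), if_neg h]
    simp

/-- The automorphism shifting the variable `k` by `-z`. -/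
noncomputable def shiftVar {σ : Type*} [DecidableEq σ] (z : ℂ) (k : σ) :
    MvPolynomial σ ℂ →ₐ[ℂ] MvPolynomial σ ℂ :=
  aeval fun j => X j - C (if j = k then z else 0)

theorem shiftVar_X {σ : Type*} [DecidableEq σ] (z : ℂ) (k j : σ) :
    shiftVar z k (X j) = X j - C (if j = k then z else 0) := aeval_X _ _

theorem shiftVar_pderiv {σ : Type*} [DecidableEq σ] (z : ℂ) (k j : σ) (f : MvPolynomial σ ℂ) :
    shiftVar z k (pderiv j f) = pderiv j (shiftVar z k f) := by
  induction f using MvPolynomial.induction_on with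
  | C a => simp [shiftVar]
  | add p q hp hq => simp [hp, hq]
  | mul_X p m hp =>
    simp only [pderiv_mul, map_add, map_mul, hp, shiftVar_X, pderiv_X, map_sub, pderiv_C, sub_zero]
    congr 2
    rw [Pi.single_apply]
    split_ifs <;> simp

theorem entrySystem_isShift [DecidableEq σ] {ι : Type*} (v : σ → ℂ) (s : n → n → ℂ)
    (idx : n → n → σ) (dg : ι → σ) (M : ι → Matrix n n ℂ)
    (hM : ∀ i k l, M i k l = if idx k l = dg i then s k l else 0) :
    (entrySystem v s idx).IsShift M fun z i => shiftVar z (dg i) where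
  map_D z i k l f := by
    rw [entrySystem_D, entrySystem_D, map_smul, shiftVar_pderiv]
  map_X z i k l := by
    rw [entrySystem_X, map_mul, shiftVar_X, hM, algebraMap_eq]
    have : shiftVar z (dg i) (C (s k l)) = C (s k l) := AlgHom.commutes _ _
    rw [this, mul_sub, ← map_mul]
    congr 2
    split_ifs <;> ring

theorem eval_shiftVar {σ : Type*} [DecidableEq σ] (z : ℂ) (k : σ) (e : σ → ℂ) (f : MvPolynomial σ ℂ) :
    eval e (shiftVar z k f) = eval (fun j => e j - if j = k then z else 0) f := by
  unfold shiftVar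
  rw [← aeval_eq_eval, ← aeval_eq_eval, ← AlgHom.comp_apply]
  congr 1
  refine algHom_ext fun j => ?_
  simp

theorem eval_shiftList {σ : Type*} [DecidableEq σ] {ι : Type*} [DecidableEq ι] (z : ℂ) {dg : ι → σ}
    (hdg : Function.Injective dg) (L : List ι) (hL : L.Nodup) (e : σ → ℂ)
    (f : MvPolynomial σ ℂ) :
    eval e (shiftList (fun i => (shiftVar z (dg i)).toLinearMap) L f) =
      eval (fun j => e j - if ∃ i ∈ L, j = dg i then z else 0) f := by
  induction L generalizing f with
  | nil => simp [shiftList]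
  | cons i L ih =>
    change eval e (shiftList (fun i => (shiftVar z (dg i)).toLinearMap) L
      (shiftVar z (dg i) f)) = _
    rw [ih hL.of_cons, eval_shiftVar]
    congr 2
    ext j
    have hi := (List.nodup_cons.mp hL).1
    by_cases h : j = dg i
    · have h2 : ¬ ∃ k ∈ L, j = dg k := fun ⟨k, hk, hjk⟩ => hi (hdg (h.symm.trans hjk) ▸ hk)
      rw [if_neg h2, if_pos h, if_pos ⟨i, by simp, h⟩, sub_zero]
    · simp [h]

end EntrySystem

end NonHermitian

/-! ### Gaussian moments and integration in independent coordinates -/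

namespace NonHermitian

open MvPolynomial MeasureTheory Complex

section Moments

theorem integrable_norm_pow_mul_exp {v : ℝ} (hv : 0 < v) (m : ℕ) :
    Integrable fun w : ℂ => ‖w‖ ^ m * Real.exp (-(‖w‖ ^ 2 / v)) := by
  have h := Complex.integral_rpow_mul_exp_neg_mul_rpow (p := 2) (q := m) (b := v⁻¹) one_le_two
    (by have : (0 : ℝ) ≤ m := Nat.cast_nonneg m
        linarith) (inv_pos.mpr hv)
  have h2 : (fun w : ℂ => ‖w‖ ^ (m : ℝ) * Real.exp (-v⁻¹ * ‖w‖ ^ (2 : ℝ))) =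
      fun w : ℂ => ‖w‖ ^ m * Real.exp (-(‖w‖ ^ 2 / v)) := by
    ext w
    rw [Real.rpow_natCast, Real.rpow_ofNat]
    congr 2
    field_simp
  rw [h2] at h
  -- A non-integrable function has integral zero by convention, whereas the known value of this
  -- integral is positive.
  by_contra hcon
  rw [integral_undef hcon] at h
  have : 0 < (2 * Real.pi / 2) * v⁻¹ ^ (-((m : ℝ) + 2) / 2) * Real.Gamma (((m : ℝ) + 2) / 2) := by
    have := Real.Gamma_pos_of_pos (s := ((m : ℝ) + 2) / 2) (by positivity)
    have := Real.pi_pos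
    positivity
  linarith

/-- The weighted monomial whose integral is a moment of a complex Gaussian variable. -/
noncomputable def gaussMonomial (v : ℝ) (a b : ℕ) (w : ℂ) : ℂ :=
  w ^ a * (starRingEnd ℂ w) ^ b * cexp (-((‖w‖ : ℂ) ^ 2 / v))

theorem integrable_gaussMonomial {v : ℝ} (hv : 0 < v) (a b : ℕ) :
    Integrable (gaussMonomial v a b) := by
  refine (integrable_norm_pow_mul_exp hv (a + b)).mono' ?_ ?_
  · apply Continuous.aestronglyMeasurable
    unfold gaussMonomial
    fun_prop
  · refine Filter.Eventually.of_forall fun w => le_of_eq ?_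
    rw [gaussMonomial, norm_mul, norm_mul, norm_pow, norm_pow, RCLike.norm_conj, pow_add,
      Complex.norm_exp]
    congr 2
    norm_cast

theorem integral_gaussMonomial {v : ℝ} (hv : 0 < v) (a b : ℕ) :
    ∫ w, gaussMonomial v a b w =
      Real.pi * v * if a = b then (a.factorial : ℂ) * (v : ℂ) ^ a else 0 := by
  by_cases h : a = b
  · subst h
    have h1 : ∀ w, gaussMonomial v a a w =
        ((‖w‖ ^ (2 * a : ℝ) * Real.exp (-v⁻¹ * ‖w‖ ^ (2 : ℝ)) : ℝ) : ℂ) := by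
      intro w
      have e1 : ‖w‖ ^ (2 * a : ℝ) = (‖w‖ ^ 2) ^ a := by
        rw [← pow_mul, ← Real.rpow_natCast]
        push_cast
        rfl
      rw [gaussMonomial, ← mul_pow, mul_conj, normSq_eq_norm_sq, e1, Real.rpow_ofNat]
      push_cast
      congr 2
      field_simp
    simp_rw [h1]
    rw [integral_complex_ofReal, Complex.integral_rpow_mul_exp_neg_mul_rpow one_le_two
      (by have : (0 : ℝ) ≤ a := Nat.cast_nonneg a
          linarith) (inv_pos.mpr hv), if_pos trivial]
    have e2 : ((2 * a + 2) / 2 : ℝ) = a + 1 := by ring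
    have e3 : (-(2 * a + 2) / 2 : ℝ) = -((a + 1 : ℕ) : ℝ) := by push_cast; ring
    rw [e2, e3, Real.Gamma_nat_eq_factorial, Real.rpow_neg (inv_nonneg.mpr hv.le),
      Real.rpow_natCast]
    push_cast
    rw [inv_pow, inv_inv, pow_succ]
    ring
  · rw [if_neg h, mul_zero]
    have hab : (a : ℝ) - b ≠ 0 := sub_ne_zero.mpr (by exact_mod_cast h)
    -- Rotation by this angle preserves area and multiplies the integrand by `exp(iπ) = -1`, so the
    -- integral equals its negative.
    set ζ : Circle := Circle.exp (Real.pi / (a - b)) with hζ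
    have h1 : ∀ w, gaussMonomial v a b (rotation ζ w) = - gaussMonomial v a b w := by
      intro w
      have e0 : (ζ : ℂ) ^ a * (starRingEnd ℂ (ζ : ℂ)) ^ b = -1 := by
        rw [hζ, Circle.coe_exp, ← Complex.exp_conj, ← Complex.exp_nat_mul, ← Complex.exp_nat_mul,
          ← Complex.exp_add, ← Complex.exp_pi_mul_I]
        congr 1
        have hab' : (a : ℂ) - b ≠ 0 := by exact_mod_cast hab
        simp only [map_mul, conj_I, conj_ofReal]
        push_cast
        field_simp
        ring
      rw [gaussMonomial, gaussMonomial, rotation_apply, norm_mul, Circle.norm_coe, one_mul,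
        map_mul, mul_pow, mul_pow]
      linear_combination (w ^ a * (starRingEnd ℂ w) ^ b * cexp (-((‖w‖ : ℂ) ^ 2 / v))) * e0
    have h2 := (rotation ζ).measurePreserving.integral_comp
      (rotation ζ).toHomeomorph.measurableEmbedding (gaussMonomial v a b)
    simp_rw [h1] at h2
    rw [integral_neg] at h2
    linear_combination (-1 / 2 : ℂ) * h2

end Moments

section Coordinates

/-- The functions `c k` behave under integration like the coordinates of a product measure. -/
def ProductCoords {σ E : Type*} [Fintype σ] [MeasureSpace E] (c : σ → E → ℂ) : Prop :=
  ∀ φ : σ → ℂ → ℂ, (∀ k, Integrable (φ k)) →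
    Integrable (fun e => ∏ k, φ k (c k e)) ∧ ∫ e, ∏ k, φ k (c k e) = ∏ k, ∫ w, φ k w

theorem productCoords_pi {σ : Type*} [Fintype σ] :
    ProductCoords fun (k : σ) (e : σ → ℂ) => e k := fun φ hφ =>
  ⟨Integrable.fintype_prod hφ, integral_fintype_prod_volume_eq_prod φ⟩

theorem productCoords_curry {ι κ : Type*} [Fintype ι] [Fintype κ] :
    ProductCoords fun (k : ι × κ) (e : ι → κ → ℂ) => e k.1 k.2 := fun φ hφ => by
  simp only [Fintype.prod_prod_type]
  refine ⟨Integrable.fintype_prod (f := fun i (x : κ → ℂ) => ∏ j, φ (i, j) (x j))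
    fun i => Integrable.fintype_prod fun j => hφ (i, j), ?_⟩
  rw [integral_fintype_prod_volume_eq_prod fun i (x : κ → ℂ) => ∏ j, φ (i, j) (x j)]
  exact Finset.prod_congr rfl fun i _ => integral_fintype_prod_volume_eq_prod fun j => φ (i, j)

theorem ProductCoords.prod {σ τ E F : Type*} [Fintype σ] [Fintype τ] [MeasureSpace E]
    [MeasureSpace F] [SFinite (volume : Measure E)] [SFinite (volume : Measure F)]
    {c : σ → E → ℂ} {d : τ → F → ℂ} (hc : ProductCoords c) (hd : ProductCoords d) :
    ProductCoords (Sum.elim (fun k (e : E × F) => c k e.1) (fun k (e : E × F) => d k e.2)) :=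
  fun φ hφ => by
    simp only [Fintype.prod_sum_type, Sum.elim_inl, Sum.elim_inr]
    have h1 := hc (fun k => φ (Sum.inl k)) fun k => hφ _
    have h2 := hd (fun k => φ (Sum.inr k)) fun k => hφ _
    refine ⟨h1.1.mul_prod h2.1, ?_⟩
    rw [← h1.2, ← h2.2]
    exact integral_prod_mul (fun e : E => ∏ k, φ (Sum.inl k) (c k e))
      (fun e : F => ∏ k, φ (Sum.inr k) (d k e))

variable {σ E : Type*} [Fintype σ] [MeasureSpace E] {c : σ → E → ℂ}

theorem ProductCoords.integral_eq_fockForm (hc : ProductCoords c) {v : σ → ℝ} (hv : ∀ k, 0 < v k)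
    (f g : MvPolynomial σ ℂ) :
    Integrable (fun e => eval (fun k => c k e) f * eval (fun k => starRingEnd ℂ (c k e)) g *
        ∏ k, cexp (-((‖c k e‖ : ℂ) ^ 2 / v k))) ∧
      ∫ e, eval (fun k => c k e) f * eval (fun k => starRingEnd ℂ (c k e)) g *
        ∏ k, cexp (-((‖c k e‖ : ℂ) ^ 2 / v k)) =
        (∏ k, (Real.pi * v k : ℂ)) * fockForm (fun k => (v k : ℂ)) f g := by
  classical
  induction f using MvPolynomial.induction_on' with
  | monomial a r =>
    induction g using MvPolynomial.induction_on' with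
    | monomial b s =>
      have h := hc (fun k => gaussMonomial (v k) (a k) (b k)) fun k =>
        integrable_gaussMonomial (hv k) _ _
      have h1 : ∀ e, eval (fun k => c k e) (monomial a r) *
          eval (fun k => starRingEnd ℂ (c k e)) (monomial b s) *
          ∏ k, cexp (-((‖c k e‖ : ℂ) ^ 2 / v k)) =
          r * s * ∏ k, gaussMonomial (v k) (a k) (b k) (c k e) := by
        intro e
        simp only [eval_monomial, Finsupp.prod_fintype _ _ (fun _ => pow_zero _), gaussMonomial,
          Finset.prod_mul_distrib]
        ring
      simp_rw [h1]
      refine ⟨h.1.const_mul _, ?_⟩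
      rw [integral_const_mul, h.2, fockForm_monomial_monomial]
      simp_rw [integral_gaussMonomial (hv _)]
      rw [Finset.prod_mul_distrib]
      ring
    | add p q hp hq =>
      have h1 : ∀ e, eval (fun k => c k e) (monomial a r) *
          eval (fun k => starRingEnd ℂ (c k e)) (p + q) *
          ∏ k, cexp (-((‖c k e‖ : ℂ) ^ 2 / v k)) =
          eval (fun k => c k e) (monomial a r) * eval (fun k => starRingEnd ℂ (c k e)) p *
            ∏ k, cexp (-((‖c k e‖ : ℂ) ^ 2 / v k)) +
          eval (fun k => c k e) (monomial a r) * eval (fun k => starRingEnd ℂ (c k e)) q *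
            ∏ k, cexp (-((‖c k e‖ : ℂ) ^ 2 / v k)) := fun e => by rw [map_add]; ring
      simp_rw [h1]
      refine ⟨hp.1.add hq.1, ?_⟩
      rw [integral_add hp.1 hq.1, hp.2, hq.2, map_add]
      ring
  | add p q hp hq =>
    have h1 : ∀ e, eval (fun k => c k e) (p + q) *
        eval (fun k => starRingEnd ℂ (c k e)) g *
        ∏ k, cexp (-((‖c k e‖ : ℂ) ^ 2 / v k)) =
        eval (fun k => c k e) p * eval (fun k => starRingEnd ℂ (c k e)) g *
          ∏ k, cexp (-((‖c k e‖ : ℂ) ^ 2 / v k)) +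
        eval (fun k => c k e) q * eval (fun k => starRingEnd ℂ (c k e)) g *
          ∏ k, cexp (-((‖c k e‖ : ℂ) ^ 2 / v k)) := fun e => by rw [map_add]; ring
    simp_rw [h1]
    refine ⟨hp.1.add hq.1, ?_⟩
    rw [integral_add hp.1 hq.1, hp.2, hq.2, map_add, LinearMap.add_apply]
    ring

end Coordinates

end NonHermitian

/-! ### Evaluation of the sums -/

namespace NonHermitian

open Finset

section ShiftSum

/-- The operator whose powers generate `shiftSum`. -/
noncomputable def shiftStep (x y : ℂ) : Module.End ℂ (ℕ → ℕ → ℂ) where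
  toFun ν b c := x * ν (b + 1) c + y * ν b (c + 1)
  map_add' ν μ := by ext; simp; ring
  map_smul' r ν := by ext; simp; ring

theorem shiftStep_pow (x y : ℂ) (k : ℕ) (ν : ℕ → ℕ → ℂ) (b c : ℕ) :
    (shiftStep x y ^ k) ν b c = ∑ m ∈ antidiagonal k,
      (k.choose m.1 : ℂ) * (x ^ m.1 * y ^ m.2 * ν (b + m.1) (c + m.2)) := by
  have h1 : shiftStep x y = shiftStep x 0 + shiftStep 0 y := by
    ext ν b c; simp [shiftStep]
  have hx : ∀ l (ν : ℕ → ℕ → ℂ) b c, (shiftStep x 0 ^ l) ν b c = x ^ l * ν (b + l) c := by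
    intro l
    induction l with
    | zero => simp
    | succ l ih =>
      intro ν b c
      rw [pow_succ, Module.End.mul_apply, ih, pow_succ]
      simp [shiftStep]
      ring_nf
  have hy : ∀ l (ν : ℕ → ℕ → ℂ) b c, (shiftStep 0 y ^ l) ν b c = y ^ l * ν b (c + l) := by
    intro l
    induction l with
    | zero => simp
    | succ l ih =>
      intro ν b c
      rw [pow_succ, Module.End.mul_apply, ih, pow_succ]
      simp [shiftStep]
      ring_nf
  have hcomm : Commute (shiftStep x 0) (shiftStep 0 y) := by
    ext ν b c
    simp [shiftStep]
    ring
  rw [h1, hcomm.add_pow', LinearMap.sum_apply, Finset.sum_apply, Finset.sum_apply]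
  refine Finset.sum_congr rfl fun m _ => ?_
  rw [LinearMap.smul_apply, Module.End.mul_apply, Pi.smul_apply, Pi.smul_apply, hx, hy,
    nsmul_eq_mul, mul_assoc]

/-- The recursion says that `shiftSum` is the `n`-th power of `1 + shiftStep`, and `shiftStep` is a
sum of two commuting weighted translations; apply the binomial theorem twice. -/
theorem shiftSum_eq (ν : ℕ → ℕ → ℂ) (x : ℂ) (n b c : ℕ) :
    shiftSum ν x n b c = ∑ q ∈ antidiagonal n, (n.choose q.1 : ℂ) *
      ∑ m ∈ antidiagonal q.2,
        (q.2.choose m.1 : ℂ) * (x ^ m.1 * (x ^ 2 / 4) ^ m.2 * ν (b + m.1) (c + m.2)) := by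
  have h : ∀ n b c, shiftSum ν x n b c = ((1 + shiftStep x (x ^ 2 / 4)) ^ n) ν b c := by
    intro n
    induction n with
    | zero => intro b c; rfl
    | succ n ih =>
      intro b c
      rw [pow_succ', Module.End.mul_apply, shiftSum, ih, ih, ih, add_assoc]
      rfl
  rw [h, (Commute.one_left _).add_pow', LinearMap.sum_apply, Finset.sum_apply, Finset.sum_apply]
  refine Finset.sum_congr rfl fun q _ => ?_
  rw [LinearMap.smul_apply, one_pow, one_mul, Pi.smul_apply, Pi.smul_apply, shiftStep_pow,
    nsmul_eq_mul]

theorem shiftSum_single (ν : ℕ → ℂ) (x : ℂ) (n : ℕ) :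
    shiftSum (fun b c => if c = 0 then ν b else 0) x n 0 0 =
      ∑ k ∈ range (n + 1), (n.choose k : ℂ) * (x ^ k * ν k) := by
  rw [shiftSum_eq, ← Finset.Nat.sum_antidiagonal_swap,
    Finset.Nat.sum_antidiagonal_eq_sum_range_succ_mk]
  refine Finset.sum_congr rfl fun k hk => ?_
  have hk : k ≤ n := Nat.lt_succ_iff.mp (Finset.mem_range.mp hk)
  rw [Finset.sum_eq_single (k, 0)]
  · simp [Nat.choose_symm hk]
  · rintro ⟨i, j⟩ hm hne
    simp only [Prod.snd_swap, Finset.HasAntidiagonal.mem_antidiagonal] at hm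
    have : j ≠ 0 := by
      rintro rfl
      exact hne (by simp at hm; simp [hm])
    simp [this]
  · intro h
    simp at h

end ShiftSum

theorem cast_choose_mul (n k : ℕ) (h : k ≤ n) :
    (n.choose k : ℂ) * (n - k).factorial = n.factorial / k.factorial := by
  have h1 : (k.factorial : ℂ) ≠ 0 := by exact_mod_cast k.factorial_ne_zero
  rw [eq_div_iff h1]
  have := Nat.choose_mul_factorial_mul_factorial h
  rw [← this]
  push_cast
  ring

theorem sum_choose_ginibre (N : ℕ) (x : ℂ) :
    ∑ k ∈ range (N + 1), (N.choose k : ℂ) * (x ^ k * ((N - k).factorial / N.factorial)) =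
      truncExp N x := by
  refine Finset.sum_congr rfl fun k hk => ?_
  have hk : k ≤ N := Nat.lt_succ_iff.mp (Finset.mem_range.mp hk)
  have h0 : (N.factorial : ℂ) ≠ 0 := by exact_mod_cast N.factorial_ne_zero
  have h1 : (k.factorial : ℂ) ≠ 0 := by exact_mod_cast k.factorial_ne_zero
  have := cast_choose_mul N k hk
  calc _ = x ^ k * ((N.choose k : ℂ) * (N - k).factorial) / N.factorial := by ring
    _ = _ := by rw [this]; field_simp

/-- Each term equals `(2x)^k / k! * (1 - k / (N + 1))`; the part with the factor `k` is a truncated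
exponential of one order less. -/
theorem sum_choose_symm (N : ℕ) (hN : 1 ≤ N) (x : ℂ) :
    ∑ k ∈ range (N + 1), (N.choose k : ℂ) *
        (x ^ k * (2 ^ k * (N - k + 1).factorial / (N + 1).factorial)) =
      truncExp N (2 * x) - 2 * x / (N + 1) * truncExp (N - 1) (2 * x) := by
  have h0 : (N.factorial : ℂ) ≠ 0 := by exact_mod_cast N.factorial_ne_zero
  have h2 : (N : ℂ) + 1 ≠ 0 := by exact_mod_cast Nat.succ_ne_zero N
  have h3 : ∀ k ∈ range (N + 1), (N.choose k : ℂ) *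
      (x ^ k * (2 ^ k * (N - k + 1).factorial / (N + 1).factorial)) =
      (2 * x) ^ k / k.factorial - (1 / (N + 1)) * (k * ((2 * x) ^ k / k.factorial)) := by
    intro k hk
    have hk : k ≤ N := Nat.lt_succ_iff.mp (Finset.mem_range.mp hk)
    have h1 : (k.factorial : ℂ) ≠ 0 := by exact_mod_cast k.factorial_ne_zero
    have := cast_choose_mul N k hk
    rw [Nat.factorial_succ, Nat.factorial_succ]
    push_cast [Nat.cast_sub hk]
    calc _ = (2 * x) ^ k * (N - k + 1) * ((N.choose k : ℂ) * (N - k).factorial) /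
          ((N + 1) * N.factorial) := by rw [mul_pow]; ring
      _ = _ := by
        rw [this]
        field_simp
        ring
  rw [Finset.sum_congr rfl h3, Finset.sum_sub_distrib, ← Finset.mul_sum]
  congr 1
  obtain ⟨M, rfl⟩ := Nat.exists_eq_add_of_le' hN
  rw [Finset.sum_range_succ' _ (M + 1), truncExp, Nat.add_sub_cancel]
  simp only [CharP.cast_eq_zero, zero_mul, add_zero, Finset.mul_sum]
  refine Finset.sum_congr rfl fun k _ => ?_
  have h1 : (k.factorial : ℂ) ≠ 0 := by exact_mod_cast k.factorial_ne_zero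
  have h4 : (k : ℂ) + 1 ≠ 0 := by exact_mod_cast Nat.succ_ne_zero k
  rw [Nat.factorial_succ]
  push_cast at h2 ⊢
  field_simp
  ring

section SelfDualSum

/-- The functional sending `y ^ m` to `m! x ^ (M - m) / 2 ^ m`. -/
noncomputable def momentFunctional (x : ℂ) (M : ℕ) : Polynomial ℂ →ₗ[ℂ] ℂ :=
  (Polynomial.basisMonomials ℂ).constr ℂ fun m => m.factorial * x ^ (M - m) / 2 ^ m

theorem momentFunctional_X_pow (x : ℂ) (M m : ℕ) :
    momentFunctional x M (Polynomial.X ^ m) = m.factorial * x ^ (M - m) / 2 ^ m := by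
  have h : (Polynomial.X ^ m : Polynomial ℂ) = Polynomial.basisMonomials ℂ m := by
    rw [Polynomial.coe_basisMonomials, Polynomial.X_pow_eq_monomial]
  rw [h, momentFunctional, Module.Basis.constr_basis]

/-- Apply `momentFunctional` to `(y + 1)^(2N)` in two ways: the binomial expansion yields the
truncated exponential, and the expansion of `(y^2 + (2y + 1))^N` yields the double sum. -/
theorem sum_trinomial (x : ℂ) (N : ℕ) :
    ∑ q ∈ antidiagonal N, ∑ m ∈ antidiagonal q.2,
        x ^ (m.1 + 2 * m.2) * (2 * q.1 + m.1).factorial /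
          (4 ^ q.1 * q.1.factorial * m.1.factorial * m.2.factorial) =
      (2 * N).factorial / (N.factorial * 4 ^ N) * truncExp (2 * N) (2 * x) := by
  have h0 : (N.factorial : ℂ) ≠ 0 := by exact_mod_cast N.factorial_ne_zero
  have e1 : momentFunctional x (2 * N) ((Polynomial.X + 1) ^ (2 * N)) =
      (2 * N).factorial / 4 ^ N * truncExp (2 * N) (2 * x) := by
    rw [(Commute.all _ _).add_pow', map_sum, ← Finset.Nat.sum_antidiagonal_swap,
      Finset.Nat.sum_antidiagonal_eq_sum_range_succ_mk, truncExp, Finset.mul_sum]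
    refine Finset.sum_congr rfl fun k hk => ?_
    have hk : k ≤ 2 * N := Nat.lt_succ_iff.mp (Finset.mem_range.mp hk)
    have h1 : (k.factorial : ℂ) ≠ 0 := by exact_mod_cast k.factorial_ne_zero
    simp only [Prod.swap_prod_mk, one_pow, mul_one]
    rw [map_nsmul, momentFunctional_X_pow, nsmul_eq_mul, Nat.choose_symm hk, Nat.sub_sub_self hk]
    have h2 := cast_choose_mul (2 * N) k hk
    have h3 : (4 : ℂ) ^ N = 2 ^ (2 * N - k) * 2 ^ k := by
      rw [← pow_add, Nat.sub_add_cancel hk, pow_mul]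
      norm_num
    calc _ = ((2 * N).choose k : ℂ) * (2 * N - k).factorial * x ^ k / 2 ^ (2 * N - k) := by ring
      _ = _ := by
        rw [h2, h3, mul_pow]
        field_simp
  have e2 : momentFunctional x (2 * N) ((Polynomial.X + 1) ^ (2 * N)) =
      ∑ q ∈ antidiagonal N, ∑ m ∈ antidiagonal q.2, N.factorial *
        (x ^ (m.1 + 2 * m.2) * (2 * q.1 + m.1).factorial /
          (4 ^ q.1 * q.1.factorial * m.1.factorial * m.2.factorial)) := by
    have h1 : (Polynomial.X + 1 : Polynomial ℂ) ^ (2 * N) =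
        (Polynomial.X ^ 2 + (Polynomial.C 2 * Polynomial.X + 1)) ^ N := by
      rw [pow_mul]
      congr 1
      have : (Polynomial.C 2 : Polynomial ℂ) = 2 := rfl
      rw [this]
      ring
    rw [h1, (Commute.all _ _).add_pow', map_sum]
    refine Finset.sum_congr rfl fun q hq => ?_
    rw [(Commute.all _ _).add_pow', Finset.mul_sum, Finset.smul_sum, map_sum]
    refine Finset.sum_congr rfl fun m hm => ?_
    obtain ⟨p, k⟩ := q
    obtain ⟨l, c⟩ := m
    simp only [Finset.HasAntidiagonal.mem_antidiagonal] at hq hm ⊢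
    subst hm
    have h4 : (Polynomial.X ^ 2) ^ p * ((l + c).choose l •
        ((Polynomial.C 2 * Polynomial.X) ^ l * 1 ^ c)) =
        (((l + c).choose l : ℂ) * 2 ^ l) • (Polynomial.X ^ (2 * p + l) : Polynomial ℂ) := by
      rw [Polynomial.smul_eq_C_mul, nsmul_eq_mul, mul_pow, one_pow, map_mul, map_pow, map_natCast,
        pow_add, pow_mul]
      ring
    rw [h4, map_nsmul, map_smul, momentFunctional_X_pow, nsmul_eq_mul, smul_eq_mul]
    have h5 : 2 * N - (2 * p + l) = l + 2 * c := by omega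
    have h6 := cast_choose_mul N p (by omega)
    have h7 := cast_choose_mul (l + c) l (by omega)
    rw [show N - p = l + c by omega] at h6
    rw [Nat.add_sub_cancel_left] at h7
    have hp : (p.factorial : ℂ) ≠ 0 := by exact_mod_cast p.factorial_ne_zero
    have hl : (l.factorial : ℂ) ≠ 0 := by exact_mod_cast l.factorial_ne_zero
    have hc : (c.factorial : ℂ) ≠ 0 := by exact_mod_cast c.factorial_ne_zero
    have hlc : ((l + c).factorial : ℂ) ≠ 0 := by exact_mod_cast (l + c).factorial_ne_zero
    have h8 : (N.choose p : ℂ) = N.factorial / (p.factorial * (l + c).factorial) := by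
      field_simp
      field_simp at h6
      linear_combination h6
    have h9 : ((l + c).choose l : ℂ) = (l + c).factorial / (l.factorial * c.factorial) := by
      field_simp
      field_simp at h7
      linear_combination h7
    rw [h5, h8, h9, pow_add x, pow_mul x, pow_add (2 : ℂ), pow_mul (2 : ℂ), show (2 : ℂ) ^ 2 = 4 by norm_num]
    field_simp
  rw [e1] at e2
  simp only [← Finset.mul_sum] at e2
  apply mul_left_cancel₀ h0
  rw [← e2]
  field_simp

/-- Writing `G N` for the left side and `H N` for the sum in `sum_trinomial`, one has `G (N + 1) = x
* G N + H (N + 1)`, which unrolls to the sum over `j`. -/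
theorem sum_selfDual (x : ℂ) (N : ℕ) :
    ∑ q ∈ antidiagonal N, ∑ m ∈ antidiagonal q.2,
        x ^ (m.1 + 2 * m.2) * (2 * q.1 + m.1 + 1).factorial /
          (4 ^ q.1 * (2 * q.1 + 1) * q.1.factorial * m.1.factorial * m.2.factorial) =
      ∑ j ∈ range (N + 1), (2 * j).factorial / (j.factorial * 4 ^ j) * x ^ (N - j) *
        truncExp (2 * j) (2 * x) := by
  set g : ℕ → ℕ → ℕ → ℂ := fun p l c => x ^ (l + 2 * c) * (2 * p + l + 1).factorial /
          (4 ^ p * (2 * p + 1) * p.factorial * l.factorial * c.factorial) with hg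
  set h : ℕ → ℕ → ℕ → ℂ := fun p l c => x ^ (l + 2 * c) * (2 * p + l).factorial /
          (4 ^ p * p.factorial * l.factorial * c.factorial) with hh
  have g0 : ∀ p c, g p 0 c = h p 0 c := by
    intro p c
    have h1 : (2 * (p : ℂ) + 1) ≠ 0 := by exact_mod_cast Nat.succ_ne_zero (2 * p)
    have hp : (p.factorial : ℂ) ≠ 0 := by exact_mod_cast p.factorial_ne_zero
    have hc : (c.factorial : ℂ) ≠ 0 := by exact_mod_cast c.factorial_ne_zero
    simp only [hg, hh, add_zero, Nat.factorial_succ]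
    push_cast
    field_simp
  -- Split the top factor of the factorial as `2p + l + 2 = (l + 1) + (2p + 1)`: the first summand
  -- cancels against `(l + 1)!`, the second against the denominator `2p + 1`.
  have g1 : ∀ p l c, g p (l + 1) c = x * g p l c + h p (l + 1) c := by
    intro p l c
    have h1 : (2 * (p : ℂ) + 1) ≠ 0 := by exact_mod_cast Nat.succ_ne_zero (2 * p)
    have h2 : (l : ℂ) + 1 ≠ 0 := by exact_mod_cast Nat.succ_ne_zero l
    have hp : (p.factorial : ℂ) ≠ 0 := by exact_mod_cast p.factorial_ne_zero
    have hc : (c.factorial : ℂ) ≠ 0 := by exact_mod_cast c.factorial_ne_zero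
    have hl : (l.factorial : ℂ) ≠ 0 := by exact_mod_cast l.factorial_ne_zero
    simp only [hg, hh, ← add_assoc, Nat.factorial_succ]
    rw [show l + 1 + 2 * c = l + 2 * c + 1 by ring, pow_succ]
    push_cast
    field_simp
    ring
  have hW : ∀ p k, ∑ m ∈ antidiagonal (k + 1), g p m.1 m.2 =
      x * ∑ m ∈ antidiagonal k, g p m.1 m.2 + ∑ m ∈ antidiagonal (k + 1), h p m.1 m.2 := by
    intro p k
    rw [Finset.Nat.sum_antidiagonal_succ, Finset.Nat.sum_antidiagonal_succ, Finset.mul_sum]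
    simp only [g0, g1, Finset.sum_add_distrib]
    ring
  change ∑ q ∈ antidiagonal N, ∑ m ∈ antidiagonal q.2, g q.1 m.1 m.2 = _
  have hG : ∀ N, ∑ q ∈ antidiagonal N, ∑ m ∈ antidiagonal q.2, h q.1 m.1 m.2 =
      (2 * N).factorial / (N.factorial * 4 ^ N) * truncExp (2 * N) (2 * x) := sum_trinomial x
  induction N with
  | zero =>
    have := hG 0
    simp only [Finset.Nat.antidiagonal_zero, Finset.sum_singleton, Finset.range_one, zero_add,
      g0] at this ⊢
    rw [this]
    simp
  | succ N ih =>
    have h1 := hG (N + 1)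
    rw [Finset.Nat.sum_antidiagonal_succ'] at h1 ⊢
    simp only [hW, Finset.sum_add_distrib, ← Finset.mul_sum, ih]
    simp only [Finset.Nat.antidiagonal_zero, Finset.sum_singleton, g0] at h1 ⊢
    rw [Finset.sum_range_succ _ (N + 1), Nat.sub_self, pow_zero, mul_one, ← h1, Finset.mul_sum]
    have h2 : ∀ j ∈ range (N + 1), x * ((2 * j).factorial / (j.factorial * 4 ^ j) * x ^ (N - j) *
        truncExp (2 * j) (2 * x)) = (2 * j).factorial / (j.factorial * 4 ^ j) * x ^ (N + 1 - j) *
        truncExp (2 * j) (2 * x) := by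
      intro j hj
      have hj : j ≤ N := Nat.lt_succ_iff.mp (Finset.mem_range.mp hj)
      rw [Nat.sub_add_comm hj, pow_succ]
      ring
    rw [Finset.sum_congr rfl h2]
    ring

theorem shiftSum_selfDualNorm (N : ℕ) (r x : ℂ) :
    shiftSum (fun b c => r * selfDualNorm N b c) x N 0 0 =
      r * (N.factorial / (2 * N).factorial * ∑ j ∈ range (N + 1),
        (2 * j).factorial / j.factorial * (4 * x) ^ (N - j) * truncExp (2 * j) (2 * x)) := by
  have h0 : ((2 * N).factorial : ℂ) ≠ 0 := by exact_mod_cast (2 * N).factorial_ne_zero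
  have e1 : ∑ j ∈ range (N + 1),
        (2 * j).factorial / j.factorial * (4 * x) ^ (N - j) * truncExp (2 * j) (2 * x) =
      4 ^ N * ∑ j ∈ range (N + 1), (2 * j).factorial / (j.factorial * 4 ^ j) * x ^ (N - j) *
        truncExp (2 * j) (2 * x) := by
    rw [Finset.mul_sum]
    refine Finset.sum_congr rfl fun j hj => ?_
    have hj : j ≤ N := Nat.lt_succ_iff.mp (Finset.mem_range.mp hj)
    have h1 : (4 : ℂ) ^ N = 4 ^ (N - j) * 4 ^ j := by rw [← pow_add, Nat.sub_add_cancel hj]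
    rw [h1, mul_pow]
    field_simp
  rw [e1, ← sum_selfDual, shiftSum_eq]
  simp only [Finset.mul_sum]
  refine Finset.sum_congr rfl fun q hq => Finset.sum_congr rfl fun m hm => ?_
  obtain ⟨p, k⟩ := q
  obtain ⟨l, c⟩ := m
  simp only [Finset.HasAntidiagonal.mem_antidiagonal] at hq hm ⊢
  subst hm
  have h6 := cast_choose_mul N p (by omega)
  have h7 := cast_choose_mul (l + c) l (by omega)
  rw [show N - p = l + c by omega] at h6
  rw [Nat.add_sub_cancel_left] at h7
  have hp : (p.factorial : ℂ) ≠ 0 := by exact_mod_cast p.factorial_ne_zero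
  have hl : (l.factorial : ℂ) ≠ 0 := by exact_mod_cast l.factorial_ne_zero
  have hc : (c.factorial : ℂ) ≠ 0 := by exact_mod_cast c.factorial_ne_zero
  have hlc : ((l + c).factorial : ℂ) ≠ 0 := by exact_mod_cast (l + c).factorial_ne_zero
  have h8 : (N.choose p : ℂ) = N.factorial / (p.factorial * (l + c).factorial) := by
    field_simp
    field_simp at h6
    linear_combination h6
  have h9 : ((l + c).choose l : ℂ) = (l + c).factorial / (l.factorial * c.factorial) := by
    field_simp
    field_simp at h7
    linear_combination h7
  have h1 : (2 * (p : ℂ) + 1) ≠ 0 := by exact_mod_cast Nat.succ_ne_zero (2 * p)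
  have h10 : N - l - c = p := by omega
  have h11 : (4 : ℂ) ^ N = 4 ^ p * 4 ^ l * 4 ^ c := by
    rw [← hq, pow_add, pow_add]; ring
  simp only [selfDualNorm, zero_add, h10]
  rw [h8, h9, h11, div_pow, ← pow_mul, pow_add x, pow_add (4 : ℂ), two_mul c, pow_add (4 : ℂ)]
  push_cast
  field_simp

end SelfDualSum

end NonHermitian

/-! ### Incomplete Gamma functions at positive integers -/

namespace NonHermitian

open MeasureTheory

theorem integrable_pow_mul_exp_neg (k : ℕ) :
    IntegrableOn (fun s : ℝ => (s : ℂ) ^ k * Complex.exp (-(s : ℂ))) (Set.Ioi 0) := by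
  have h := Complex.GammaIntegral_convergent (s := (k : ℂ) + 1) (by
    simp only [Complex.add_re, Complex.natCast_re, Complex.one_re]; positivity)
  refine h.congr_fun (fun s _ => ?_) measurableSet_Ioi
  simp only [add_sub_cancel_right, Complex.cpow_natCast]
  push_cast
  ring

theorem integral_pow_mul_exp_neg (k : ℕ) :
    ∫ s in Set.Ioi (0 : ℝ), (s : ℂ) ^ k * Complex.exp (-(s : ℂ)) = k.factorial := by
  rw [← Complex.Gamma_nat_eq_factorial, Complex.Gamma_eq_integral (by
    simp only [Complex.add_re, Complex.natCast_re, Complex.one_re]; positivity),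
    Complex.GammaIntegral]
  refine setIntegral_congr_fun measurableSet_Ioi fun s _ => ?_
  simp only [add_sub_cancel_right, Complex.cpow_natCast]
  push_cast
  ring

/-- Expand `(x + s)^n` by the binomial theorem and integrate each power of `s` to a factorial. -/
theorem upperGamma_natCast_add_one (n : ℕ) (x : ℂ) :
    upperGamma (n + 1) x = n.factorial * Complex.exp (-x) * truncExp n x := by
  have h : ∀ s : ℝ, (x + (s : ℂ)) ^ ((n : ℂ) + 1 - 1) * Complex.exp (-(x + (s : ℂ))) =
      ∑ k ∈ Finset.range (n + 1), (Complex.exp (-x) * x ^ k * n.choose k) *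
        ((s : ℂ) ^ (n - k) * Complex.exp (-(s : ℂ))) := by
    intro s
    rw [add_sub_cancel_right, Complex.cpow_natCast, add_pow, neg_add, Complex.exp_add,
      Finset.sum_mul]
    refine Finset.sum_congr rfl fun k _ => ?_
    ring
  rw [upperGamma]
  simp_rw [h]
  rw [integral_finsetSum _ fun k _ => (integrable_pow_mul_exp_neg (n - k)).const_mul _, truncExp,
    Finset.mul_sum]
  refine Finset.sum_congr rfl fun k hk => ?_
  have := cast_choose_mul n k (Nat.lt_succ_iff.mp (Finset.mem_range.mp hk))
  rw [integral_const_mul, integral_pow_mul_exp_neg, mul_assoc _ (n.choose k : ℂ), this]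
  ring

theorem exp_mul_regGammaQ (n : ℕ) (x : ℂ) :
    Complex.exp x * regGammaQ (n + 1) x = truncExp n x := by
  have h0 : (n.factorial : ℂ) ≠ 0 := by exact_mod_cast n.factorial_ne_zero
  rw [regGammaQ, upperGamma_natCast_add_one, Complex.Gamma_nat_eq_factorial]
  have h1 : Complex.exp x * Complex.exp (-x) = 1 := by
    rw [← Complex.exp_add, add_neg_cancel, Complex.exp_zero]
  field_simp
  linear_combination truncExp n x * h1

end NonHermitian

/-! ### From averages to the form -/

namespace NonHermitian

open MvPolynomial MeasureTheory

section FockPositive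

variable {σ : Type*} [Fintype σ]

/-- The form is bilinear, not sesquilinear, but on polynomials with real coefficients it is a
positive combination of squares of coefficients. -/
theorem fockForm_map_self_ne_zero {v : σ → ℝ} (hv : ∀ k, 0 < v k) {g : MvPolynomial σ ℝ}
    (hg : g ≠ 0) :
    fockForm (fun k => (v k : ℂ)) (map Complex.ofRealHom g) (map Complex.ofRealHom g) ≠ 0 := by
  have h : fockForm (fun k => (v k : ℂ)) (map Complex.ofRealHom g) (map Complex.ofRealHom g) =
      ((∑ a ∈ g.support, (∏ k, ((a k).factorial : ℝ) * v k ^ a k) * coeff a g ^ 2 : ℝ) : ℂ) := by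
    conv_lhs => arg 1; rw [g.as_sum]
    rw [map_sum, map_sum, LinearMap.sum_apply, Complex.ofReal_sum]
    refine Finset.sum_congr rfl fun a _ => ?_
    rw [map_monomial, fockForm_monomial, coeff_map, fockWeight]
    simp only [Complex.ofRealHom_eq_coe]
    push_cast
    ring
  rw [h, Complex.ofReal_ne_zero]
  refine (Finset.sum_pos (fun a ha => ?_) (support_nonempty.mpr hg)).ne'
  have h1 := mem_support_iff.mp ha
  refine mul_pos (Finset.prod_pos fun k _ => ?_) (by positivity)
  exact mul_pos (by exact_mod_cast (a k).factorial_pos) (pow_pos (hv k) _)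

end FockPositive

section EntryAverage

variable {σ n m E : Type*} [Fintype σ] [Fintype n] [DecidableEq n] [Fintype m] [DecidableEq m]

/-- The matrix whose entry at `i j` is `t i j` times the coordinate `idx i j`. -/
def entryMatrix (t : n → n → ℝ) (idx : n → n → σ) (a : σ → ℂ) : Matrix n n ℂ :=
  Matrix.of fun i j => t i j * a (idx i j)

variable (v : σ → ℝ) (t : n → n → ℝ) (idx : n → n → σ)

/-- `entrySystem` for real variances and coefficients. -/
noncomputable abbrev realEntrySystem : WickSystem n (MvPolynomial σ ℂ) :=
  entrySystem (fun k => (v k : ℂ)) (fun i j => (t i j : ℂ)) idx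

theorem eval_det_realEntrySystem (a : σ → ℂ) :
    eval a (realEntrySystem v t idx).X.det = (entryMatrix t idx a).det := by
  rw [RingHom.map_det]
  congr 1
  ext i j
  simp [entrySystem_X, entryMatrix]

theorem realEntrySystem_form_det_ne_zero (hv : ∀ k, 0 < v k)
    (h : (realEntrySystem v t idx).X.det ≠ 0) :
    (realEntrySystem v t idx).B (realEntrySystem v t idx).X.det
      (realEntrySystem v t idx).X.det ≠ 0 := by
  have h1 : (realEntrySystem v t idx).X.det = map Complex.ofRealHom
      (Matrix.of fun i j => C (t i j) * X (idx i j) : Matrix n n (MvPolynomial σ ℝ)).det := by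
    rw [RingHom.map_det]
    congr 1
    ext1 i j
    simp [entrySystem_X]
  have h2 : (Matrix.of fun i j => C (t i j) * X (idx i j) :
      Matrix n n (MvPolynomial σ ℝ)).det ≠ 0 := by
    intro h3
    rw [h1, h3, map_zero] at h
    exact h rfl
  rw [h1]
  exact fockForm_map_self_ne_zero hv h2

/-- The matrix family `M` on the space `E` is, up to sign in the determinant, given by
`entryMatrix t idx`, its diagonal entries are the variables `dg i`, and its Gaussian weight is the
one of independent complex Gaussian coordinates `c` with variances `v`. -/
structure IsEntryModel {ι : Type*} [Fintype ι] [DecidableEq σ] [MeasureSpace E] [Star E] (dg : ι → σ) (c : σ → E → ℂ)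
    (M : E → Matrix m m ℂ) : Prop where
  coords : ProductCoords c
  pos : ∀ k, 0 < v k
  inj : Function.Injective dg
  weight : ∀ e, gaussWeight (M e) = ∏ k, Complex.exp (-((‖c k e‖ : ℂ) ^ 2 / v k))
  coords_star : ∀ k e, c k (star e) = starRingEnd ℂ (c k e)
  map_star : ∀ e, (M e).map (starRingEnd ℂ) = M (star e)
  det : ∃ δ : ℂ, δ * δ = 1 ∧ ∀ z e, (z • (1 : Matrix m m ℂ) - M e).det = δ *
    (entryMatrix t idx fun j => c j e - if ∃ i, j = dg i then z else 0).det
  det_ne_zero : ∃ a, (entryMatrix t idx a).det ≠ 0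

variable {v t idx} {ι : Type*} [Fintype ι] [DecidableEq σ] [MeasureSpace E] [Star E] {dg : ι → σ} {c : σ → E → ℂ}
    {M : E → Matrix m m ℂ}

theorem IsEntryModel.X_det_ne_zero (h : IsEntryModel v t idx dg c M) :
    (realEntrySystem v t idx).X.det ≠ 0 := by
  intro h0
  obtain ⟨a, ha⟩ := h.det_ne_zero
  rw [← eval_det_realEntrySystem v, h0, map_zero] at ha
  exact ha rfl

theorem IsEntryModel.form_det_ne_zero (h : IsEntryModel v t idx dg c M) :
    (realEntrySystem v t idx).B (realEntrySystem v t idx).X.det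
      (realEntrySystem v t idx).X.det ≠ 0 :=
  realEntrySystem_form_det_ne_zero v t idx h.pos h.X_det_ne_zero

/-- Conjugating the matrix conjugates the coordinates, so the second determinant is a polynomial in
the conjugated coordinates. The sign `δ` enters twice and disappears, and the product of the `π * v
k` cancels against the partition function. -/
theorem IsEntryModel.average_charPair (h : IsEntryModel v t idx dg c M) (z w : ℂ) :
    AverageConverges M (charPair z w) ∧ average M (charPair z w) =
      (realEntrySystem v t idx).B
        (shiftList (fun i => (shiftVar z (dg i)).toLinearMap) Finset.univ.toList
          (realEntrySystem v t idx).X.det)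
        (shiftList (fun i => (shiftVar w (dg i)).toLinearMap) Finset.univ.toList
          (realEntrySystem v t idx).X.det) := by
  classical
  obtain ⟨δ, hδ, hdet⟩ := h.det
  have hs : ∀ z a, eval a (shiftList (fun i => (shiftVar z (dg i)).toLinearMap)
      Finset.univ.toList (realEntrySystem v t idx).X.det) =
      (entryMatrix t idx fun j => a j - if ∃ i, j = dg i then z else 0).det := by
    intro z a
    rw [eval_shiftList z h.inj _ (Finset.nodup_toList _), eval_det_realEntrySystem]
    congr 2
    ext j
    simp
  have h1 : ∀ e, charPair z w (M e) * gaussWeight (M e) =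
      eval (fun k => c k e) (shiftList (fun i => (shiftVar z (dg i)).toLinearMap)
          Finset.univ.toList (realEntrySystem v t idx).X.det) *
        eval (fun k => starRingEnd ℂ (c k e))
          (shiftList (fun i => (shiftVar w (dg i)).toLinearMap) Finset.univ.toList
            (realEntrySystem v t idx).X.det) *
        ∏ k, Complex.exp (-((‖c k e‖ : ℂ) ^ 2 / v k)) := by
    intro e
    rw [hs, hs, ← h.weight, charPair, h.map_star, hdet, hdet]
    simp only [h.coords_star]
    linear_combination ((entryMatrix t idx fun j =>
      c j e - if ∃ i, j = dg i then z else 0).det * (entryMatrix t idx fun j =>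
      starRingEnd ℂ (c j e) - if ∃ i, j = dg i then w else 0).det * gaussWeight (M e)) * hδ
  have h2 := h.coords.integral_eq_fockForm h.pos 1 1
  have h3 := h.coords.integral_eq_fockForm h.pos
    (shiftList (fun i => (shiftVar z (dg i)).toLinearMap) Finset.univ.toList
      (realEntrySystem v t idx).X.det)
    (shiftList (fun i => (shiftVar w (dg i)).toLinearMap) Finset.univ.toList
      (realEntrySystem v t idx).X.det)
  simp only [← h1] at h3
  simp only [map_one, one_mul, ← h.weight] at h2
  refine ⟨⟨h2.1, h3.1⟩, ?_⟩
  have h4 : fockForm (fun k => (v k : ℂ)) 1 1 = 1 := by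
    have : (1 : MvPolynomial σ ℂ) = monomial 0 1 := rfl
    rw [this, fockForm_monomial_monomial]
    simp
  have h5 : (∏ k, (Real.pi * v k : ℂ)) ≠ 0 := Finset.prod_ne_zero_iff.mpr fun k _ =>
    mul_ne_zero (by exact_mod_cast Real.pi_ne_zero) (by exact_mod_cast (h.pos k).ne')
  rw [average, partitionFn, h2.2, h3.2, h4, mul_one, inv_mul_cancel_left₀ h5]
  rfl

end EntryAverage

end NonHermitian

/-! ### Classes A and AI† as entry models -/

namespace NonHermitian

open MeasureTheory

theorem gaussWeight_eq {n : Type*} [Fintype n] [DecidableEq n] (J : Matrix n n ℂ) :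
    gaussWeight J = Complex.exp (-∑ i, ∑ j, (‖J i j‖ : ℂ) ^ 2) := by
  rw [gaussWeight, Matrix.trace]
  congr 2
  refine Finset.sum_congr rfl fun i _ => ?_
  rw [Matrix.diag_apply, Matrix.mul_apply]
  refine Finset.sum_congr rfl fun j _ => ?_
  rw [Matrix.conjTranspose_apply, Complex.star_def, Complex.mul_conj, Complex.normSq_eq_norm_sq]
  push_cast
  rfl

theorem prod_exp_neg_eq {σ : Type*} [Fintype σ] (f : σ → ℂ) :
    ∏ k, Complex.exp (-f k) = Complex.exp (-∑ k, f k) := by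
  rw [← Complex.exp_sum, Finset.sum_neg_distrib]

section Triangle

variable {N : ℕ} (g : Fin N → Fin N → ℂ)

theorem sum_upper_triangle (hg : ∀ i j, g i j = g j i) :
    ∑ i, ∑ j, g i j = ∑ p : {p : Fin N × Fin N // p.1 ≤ p.2},
      if p.1.1 = p.1.2 then g p.1.1 p.1.2 else 2 * g p.1.1 p.1.2 := by
  rw [← Finset.sum_subtype (Finset.univ.filter fun p : Fin N × Fin N => p.1 ≤ p.2) (by simp)
    fun p : Fin N × Fin N => if p.1 = p.2 then g p.1 p.2 else 2 * g p.1 p.2, Finset.sum_filter]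
  have h1 : ∑ i, ∑ j, g i j = ∑ p : Fin N × Fin N, (if p.1 ≤ p.2 then g p.1 p.2 else 0) +
      ∑ p : Fin N × Fin N, (if p.1 < p.2 then g p.1 p.2 else 0) := by
    rw [← (Equiv.prodComm (Fin N) (Fin N)).sum_comp
      fun p : Fin N × Fin N => (if p.1 < p.2 then g p.1 p.2 else 0), ← Finset.sum_add_distrib,
      ← Fintype.sum_prod_type']
    refine Finset.sum_congr rfl fun p _ => ?_
    rcases le_or_gt p.1 p.2 with h | h
    · simp [h, not_lt.mpr h]
    · simp [h, not_le.mpr h, hg p.2 p.1]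
  rw [h1, ← Finset.sum_add_distrib]
  refine Finset.sum_congr rfl fun p _ => ?_
  rcases lt_trichotomy p.1 p.2 with h | h | h
  · simp [h, h.le, h.ne, two_mul]
  · simp [h]
  · simp [not_le.mpr h, not_lt.mpr h.le]

theorem sum_strict_triangle (hg : ∀ i j, g i j = g j i) (h0 : ∀ i, g i i = 0) :
    ∑ i, ∑ j, g i j = ∑ p : {p : Fin N × Fin N // p.1 < p.2}, 2 * g p.1.1 p.1.2 := by
  rw [sum_upper_triangle g hg,
    ← Finset.sum_subtype (Finset.univ.filter fun p : Fin N × Fin N => p.1 ≤ p.2) (by simp)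
    fun p : Fin N × Fin N => if p.1 = p.2 then g p.1 p.2 else 2 * g p.1 p.2, Finset.sum_filter,
    ← Finset.sum_subtype (Finset.univ.filter fun p : Fin N × Fin N => p.1 < p.2) (by simp)
    fun p : Fin N × Fin N => 2 * g p.1 p.2, Finset.sum_filter]
  refine Finset.sum_congr rfl fun p _ => ?_
  rcases lt_trichotomy p.1 p.2 with h | h | h
  · simp [h, h.le, h.ne]
  · simp [h, h0]
  · simp [not_le.mpr h, not_lt.mpr h.le]

end Triangle

theorem truncExp_zero (n : ℕ) : truncExp n 0 = 1 := by
  rw [truncExp, Finset.sum_range_succ']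
  simp

section Ginibre

variable (N : ℕ)

theorem ginibre_isEntryModel :
    IsEntryModel (fun _ : Fin N × Fin N => 1) (fun _ _ => 1) Prod.mk (fun i : Fin N => (i, i))
      (fun (k : Fin N × Fin N) (e : Fin N → Fin N → ℂ) => e k.1 k.2) (ginibre N) where
  coords := productCoords_curry
  pos _ := one_pos
  inj i j h := congrArg Prod.fst h
  weight e := by
    rw [gaussWeight_eq, prod_exp_neg_eq, ← Fintype.sum_prod_type']
    simp [ginibre]
  coords_star k e := rfl
  map_star e := rfl
  det := by
    refine ⟨(-1) ^ N, by rw [← mul_pow]; simp, fun z e => ?_⟩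
    rw [← neg_sub, Matrix.det_neg, Fintype.card_fin]
    congr 2
    ext i j
    simp [ginibre, entryMatrix, Matrix.one_apply, eq_comm]
  det_ne_zero := ⟨fun k => (1 : Matrix (Fin N) (Fin N) ℂ) k.1 k.2, by
    have : entryMatrix (fun _ _ => 1) Prod.mk
      (fun k : Fin N × Fin N => (1 : Matrix (Fin N) (Fin N) ℂ) k.1 k.2) = 1 := by
      ext i j
      simp [entryMatrix]
    rw [this]
    simp⟩

theorem ginibre_average : ∃ r : ℂ, r ≠ 0 ∧ ∀ z w, AverageConverges (ginibre N) (charPair z w) ∧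
    dA N z w = r * truncExp N (z * w) := by
  have h := ginibre_isEntryModel N
  refine ⟨_, h.form_det_ne_zero, fun z w => ⟨(h.average_charPair z w).1, ?_⟩⟩
  have hS : (realEntrySystem (fun _ : Fin N × Fin N => 1) (fun _ _ => 1) Prod.mk).IsGinibre := by
    intro i j k l
    rw [entrySystem_D_X]
    by_cases h1 : i = k <;> by_cases h2 : j = l <;> simp [h1, h2]
  have hT := entrySystem_isShift (fun _ : Fin N × Fin N => ((1 : ℝ) : ℂ))
    (fun _ _ => ((1 : ℝ) : ℂ)) Prod.mk (fun i : Fin N => (i, i))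
    (fun i => Matrix.single i i 1) fun i k l => by
      simp [Matrix.single_apply, eq_comm]
  rw [dA, (h.average_charPair z w).2, hS.form_shift h.X_det_ne_zero hT,
    shiftSum_single (fun b => _ * (((Fintype.card (Fin N) - b).factorial : ℂ) / _)),
    ← sum_choose_ginibre, Finset.mul_sum, Fintype.card_fin]
  refine Finset.sum_congr rfl fun k _ => ?_
  ring

end Ginibre

section Symmetric

variable (N : ℕ)

/-- The position on or above the diagonal equivalent to `i j`. -/
def symIndex (i j : Fin N) : {p : Fin N × Fin N // p.1 ≤ p.2} :=
  if h : i ≤ j then ⟨(i, j), h⟩ else ⟨(j, i), le_of_lt (not_le.mp h)⟩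

theorem symIndex_eq_iff (i j k l : Fin N) :
    symIndex N i j = symIndex N k l ↔ (i = k ∧ j = l) ∨ (i = l ∧ j = k) := by
  unfold symIndex
  split_ifs with h1 h2 h2 <;> simp only [Subtype.mk.injEq, Prod.mk.injEq] <;> omega

theorem symMatrix_apply (e : {p : Fin N × Fin N // p.1 ≤ p.2} → ℂ) (i j : Fin N) :
    symMatrix N e i j = e (symIndex N i j) := by
  unfold symIndex symMatrix
  rw [Matrix.of_apply]
  split_ifs <;> rfl

/-- The variances of the independent entries of a symmetric matrix. -/
noncomputable def symVariance (p : {p : Fin N × Fin N // p.1 ≤ p.2}) : ℝ :=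
  if p.1.1 = p.1.2 then 1 else 1 / 2

theorem symVariance_symIndex (i j : Fin N) :
    symVariance N (symIndex N i j) = if i = j then 1 else 1 / 2 := by
  unfold symIndex symVariance
  split_ifs <;> simp_all

/-- An off-diagonal entry occurs twice in the trace, hence has variance one half. The sign relating
`z - J` to `J - z` is `(-1) ^ N`. -/
theorem symMatrix_isEntryModel :
    IsEntryModel (symVariance N) (fun _ _ => 1) (symIndex N) (fun i : Fin N => symIndex N i i)
      (fun k (e : {p : Fin N × Fin N // p.1 ≤ p.2} → ℂ) => e k) (symMatrix N) where
  coords := productCoords_pi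
  pos k := by
    unfold symVariance
    split_ifs <;> norm_num
  inj i j h := by
    simpa using (symIndex_eq_iff N i i j j).mp h
  weight e := by
    rw [gaussWeight_eq, prod_exp_neg_eq, sum_upper_triangle]
    · congr 2
      refine Finset.sum_congr rfl fun p _ => ?_
      have h : symIndex N p.1.1 p.1.2 = p := dif_pos p.2
      rw [symMatrix_apply, h, symVariance]
      split_ifs <;> simp
      ring
    · intro i j
      have : symIndex N i j = symIndex N j i := by simp [symIndex_eq_iff]
      rw [symMatrix_apply, symMatrix_apply, this]
  coords_star k e := rfl
  map_star e := by
    ext i j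
    rw [Matrix.map_apply, symMatrix_apply, symMatrix_apply]
    rfl
  det := by
    refine ⟨(-1) ^ N, by rw [← mul_pow]; simp, fun z e => ?_⟩
    rw [← neg_sub, Matrix.det_neg, Fintype.card_fin]
    congr 2
    ext i j
    by_cases h : i = j
    · subst h
      simp [symMatrix_apply, entryMatrix, symIndex_eq_iff]
    · simp [symMatrix_apply, entryMatrix, symIndex_eq_iff, h, Ne.symm h]
  det_ne_zero := ⟨fun k => (1 : Matrix (Fin N) (Fin N) ℂ) k.1.1 k.1.2, by
    have : entryMatrix (fun _ _ => 1) (symIndex N) (fun k =>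
        (1 : Matrix (Fin N) (Fin N) ℂ) k.1.1 k.1.2) = 1 := by
      ext i j
      by_cases h : i ≤ j <;> simp [entryMatrix, symIndex, h, Matrix.one_apply, eq_comm]
    rw [this]
    simp⟩

theorem symMatrix_average (hN : 1 ≤ N) : ∃ r : ℂ, r ≠ 0 ∧ ∀ z w,
    AverageConverges (symMatrix N) (charPair z w) ∧ dAI N z w =
      r * (truncExp N (2 * (z * w)) - 2 * (z * w) / (N + 1) * truncExp (N - 1) (2 * (z * w))) := by
  have h := symMatrix_isEntryModel N
  refine ⟨_, h.form_det_ne_zero, fun z w => ⟨(h.average_charPair z w).1, ?_⟩⟩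
  have hswap : ∀ i j, symIndex N j i = symIndex N i j := by simp [symIndex_eq_iff]
  have hS : (realEntrySystem (symVariance N) (fun _ _ => 1) (symIndex N)).IsPaired 1 := by
    refine ⟨one_mul 1, fun i j => ?_, fun i j f => ?_, fun i j k l => ?_⟩
    · rw [entrySystem_X, entrySystem_X, hswap, one_mul]
    · rw [entrySystem_D, entrySystem_D, hswap, one_mul]
    · have h2 : (2 : MvPolynomial {p : Fin N × Fin N // p.1 ≤ p.2} ℂ) = MvPolynomial.C 2 := rfl
      rw [entrySystem_D_X, symVariance_symIndex, h2, ← map_mul]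
      simp only [symIndex_eq_iff]
      rw [← MvPolynomial.C_1, ← MvPolynomial.C_0]
      simp only [← apply_ite (MvPolynomial.C (σ := {p : Fin N × Fin N // p.1 ≤ p.2})), ← map_mul, ← map_add]
      congr 1
      by_cases h1 : i = k <;> by_cases h2 : j = l <;> by_cases h3 : i = l <;>
        by_cases h4 : j = k <;> by_cases h5 : i = j <;> (simp_all; try norm_num)
  have hT := entrySystem_isShift (fun k => (symVariance N k : ℂ))
    (fun _ _ => ((1 : ℝ) : ℂ)) (symIndex N) (fun i : Fin N => symIndex N i i)
    (fun i => Matrix.single i i 1) fun i k l => by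
      rw [Matrix.single_apply]
      simp only [symIndex_eq_iff, Complex.ofReal_one]
      exact if_congr (by grind) rfl rfl
  rw [dAI, (h.average_charPair z w).2, hS.form_shift_symm h.X_det_ne_zero hT,
    shiftSum_single (fun b => _ * (2 ^ b * ((Fintype.card (Fin N) - b + 1).factorial : ℂ) / _)),
    ← sum_choose_symm N hN, Finset.mul_sum, Fintype.card_fin]
  refine Finset.sum_congr rfl fun k _ => ?_
  ring

end Symmetric

end NonHermitian

/-! ### Class AII† as an entry model -/

namespace NonHermitian

open MeasureTheory

section SelfDual

variable (N : ℕ)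

/-- The index set of the independent entries of a self-dual matrix. -/
abbrev SelfDualIndex : Type :=
  (Fin N × Fin N) ⊕ ({p : Fin N × Fin N // p.1 < p.2} ⊕ {p : Fin N × Fin N // p.1 < p.2})

/-- The independent entries of a self-dual matrix as coordinates. -/
def selfDualCoord : SelfDualIndex N → (Fin N → Fin N → ℂ) ×
    (({p : Fin N × Fin N // p.1 < p.2} → ℂ) × ({p : Fin N × Fin N // p.1 < p.2} → ℂ)) → ℂ
  | Sum.inl k, e => e.1 k.1 k.2
  | Sum.inr (Sum.inl k), e => e.2.1 k
  | Sum.inr (Sum.inr k), e => e.2.2 k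

theorem productCoords_selfDualCoord : ProductCoords (selfDualCoord N) := by
  convert (productCoords_curry (ι := Fin N) (κ := Fin N)).prod
    ((productCoords_pi (σ := {p : Fin N × Fin N // p.1 < p.2})).prod
      (productCoords_pi (σ := {p : Fin N × Fin N // p.1 < p.2}))) using 1
  ext k e
  rcases k with k | k | k <;> rfl

/-- The position above the diagonal equivalent to `i j`, embedded by `f`. The diagonal is sent to
a dummy index. -/
def strictIndex (f : {p : Fin N × Fin N // p.1 < p.2} → SelfDualIndex N) (i j : Fin N) :
    SelfDualIndex N :=
  if h : i < j then f ⟨(i, j), h⟩ else if h : j < i then f ⟨(j, i), h⟩ else Sum.inl (i, i)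

/-- The sign of the entry `i j` of an antisymmetric matrix. -/
def strictSign (i j : Fin N) : ℝ := if i < j then 1 else if j < i then -1 else 0

theorem strictSign_swap (i j : Fin N) : strictSign N j i = -strictSign N i j := by
  unfold strictSign
  rcases lt_trichotomy i j with h | h | h
  · simp [h, not_lt.mpr h.le]
  · simp [h]
  · simp [h, not_lt.mpr h.le]

theorem strictIndex_swap (f : {p : Fin N × Fin N // p.1 < p.2} → SelfDualIndex N) (i j : Fin N) :
    strictIndex N f j i = strictIndex N f i j := by
  unfold strictIndex
  rcases lt_trichotomy i j with h | h | h
  · simp [h, not_lt.mpr h.le]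
  · simp [h]
  · simp [h, not_lt.mpr h.le]

/-- The coefficients of the antisymmetric matrix `[[-B, A], [-Aᵀ, C]]`. -/
def selfDualSign : Fin N ⊕ Fin N → Fin N ⊕ Fin N → ℝ
  | Sum.inl i, Sum.inl j => -strictSign N i j
  | Sum.inl _, Sum.inr _ => 1
  | Sum.inr _, Sum.inl _ => -1
  | Sum.inr i, Sum.inr j => strictSign N i j

/-- The variables of the antisymmetric matrix `[[-B, A], [-Aᵀ, C]]`. -/
def selfDualIndex : Fin N ⊕ Fin N → Fin N ⊕ Fin N → SelfDualIndex N
  | Sum.inl i, Sum.inl j => strictIndex N (fun p => Sum.inr (Sum.inl p)) i j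
  | Sum.inl i, Sum.inr j => Sum.inl (i, j)
  | Sum.inr i, Sum.inl j => Sum.inl (j, i)
  | Sum.inr i, Sum.inr j => strictIndex N (fun p => Sum.inr (Sum.inr p)) i j

theorem selfDualSign_swap (i j : Fin N ⊕ Fin N) :
    selfDualSign N j i = -selfDualSign N i j := by
  rcases i with i | i <;> rcases j with j | j <;> simp [selfDualSign, strictSign_swap N i j]

theorem selfDualIndex_swap (i j : Fin N ⊕ Fin N) :
    selfDualIndex N j i = selfDualIndex N i j := by
  rcases i with i | i <;> rcases j with j | j <;>
    simp [selfDualIndex, strictIndex_swap N _ i j]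

theorem antisymMatrix_apply (e : {p : Fin N × Fin N // p.1 < p.2} → ℂ)
    (f : {p : Fin N × Fin N // p.1 < p.2} → SelfDualIndex N) (a : SelfDualIndex N → ℂ)
    (h : ∀ p, a (f p) = e p) (i j : Fin N) :
    antisymMatrix N e i j = strictSign N i j * a (strictIndex N f i j) := by
  unfold strictSign strictIndex antisymMatrix
  rw [Matrix.of_apply]
  split_ifs <;> simp [h]

theorem strictIndex_sign_mul (f : {p : Fin N × Fin N // p.1 < p.2} → SelfDualIndex N)
    (hf : Function.Injective f) (i j k l : Fin N) :
    (if strictIndex N f i j = strictIndex N f k l then strictSign N i j * strictSign N k l else 0) =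
      (if i = k then 1 else 0) * (if j = l then 1 else 0) -
        (if i = l then 1 else 0) * (if j = k then 1 else 0) := by
  rcases lt_trichotomy i j with h | h | h <;> rcases lt_trichotomy k l with h' | h' | h' <;>
    simp [strictIndex, strictSign, h, h', not_lt.mpr h.le, not_lt.mpr h'.le, hf.eq_iff] <;>
    grind

/-- The dummy index on the diagonal of `B` or `C` coincides with a variable of `A`, which is
harmless because its coefficient is zero. -/
theorem strictSign_eq_zero_of_strictIndex_eq (f : {p : Fin N × Fin N // p.1 < p.2} → SelfDualIndex N)
    {k : SelfDualIndex N} (hk : ∀ p, f p ≠ k) (i j : Fin N) (h : strictIndex N f i j = k) :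
    strictSign N i j = 0 := by
  unfold strictIndex at h
  unfold strictSign
  split_ifs at h ⊢ with h1 h2
  · exact absurd h (hk _)
  · exact absurd h (hk _)
  · rfl

/-- The sign products over matching variables are the covariance pattern of an antisymmetric matrix;
with variance one half this is the last condition of `IsPaired (-1)`. -/
theorem selfDualIndex_sign_mul (i j k l : Fin N ⊕ Fin N) :
    (if selfDualIndex N i j = selfDualIndex N k l then
        selfDualSign N i j * selfDualSign N k l else 0) =
      (if i = k then 1 else 0) * (if j = l then 1 else 0) -
        (if i = l then 1 else 0) * (if j = k then 1 else 0) := by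
  have hl : Function.Injective fun p : {p : Fin N × Fin N // p.1 < p.2} =>
      (Sum.inr (Sum.inl p) : SelfDualIndex N) := Sum.inr_injective.comp Sum.inl_injective
  have hr : Function.Injective fun p : {p : Fin N × Fin N // p.1 < p.2} =>
      (Sum.inr (Sum.inr p) : SelfDualIndex N) := Sum.inr_injective.comp Sum.inr_injective
  have el := strictIndex_sign_mul N _ hl
  have er := strictIndex_sign_mul N _ hr
  have zl : ∀ i j k, strictIndex N (fun p => Sum.inr (Sum.inl p)) i j = Sum.inl k →
      strictSign N i j = 0 := fun i j k =>
    strictSign_eq_zero_of_strictIndex_eq N _ (fun p => by simp) i j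
  have zr : ∀ i j k, strictIndex N (fun p => Sum.inr (Sum.inr p)) i j = Sum.inl k →
      strictSign N i j = 0 := fun i j k =>
    strictSign_eq_zero_of_strictIndex_eq N _ (fun p => by simp) i j
  have zlr : ∀ i j k l, strictIndex N (fun p => Sum.inr (Sum.inl p)) i j =
      strictIndex N (fun p => Sum.inr (Sum.inr p)) k l → strictSign N i j = 0 := fun i j k l =>
    strictSign_eq_zero_of_strictIndex_eq N _ (fun p => by unfold strictIndex; split_ifs <;> simp) i j
  rcases i with i | i <;> rcases j with j | j <;> rcases k with k | k <;> rcases l with l | l <;>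
    simp only [selfDualIndex, selfDualSign, Sum.inl.injEq, Sum.inr.injEq, reduceCtorEq, if_false,
      Prod.mk.injEq, neg_mul_neg, el] <;>
    grind

/-- Self-duality of `J` means exactly that its product with the symplectic unit is antisymmetric:
the product here is `[[-B, A - z], [z - Aᵀ, C]]`. -/
theorem sub_selfDual_mul_J (z : ℂ) (e : (Fin N → Fin N → ℂ) ×
    (({p : Fin N × Fin N // p.1 < p.2} → ℂ) × ({p : Fin N × Fin N // p.1 < p.2} → ℂ)))
    (d : SelfDualIndex N → ℂ) (hd : ∀ i j, d (Sum.inl (i, j)) = if i = j then z else 0)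
    (hd' : ∀ p, d (Sum.inr p) = 0) :
    (z • (1 : Matrix (Fin N ⊕ Fin N) (Fin N ⊕ Fin N) ℂ) - selfDual N e) * Matrix.J (Fin N) ℂ =
      entryMatrix (selfDualSign N) (selfDualIndex N) fun j => selfDualCoord N j e - d j := by
  have hB := antisymMatrix_apply N e.2.1 (fun p => Sum.inr (Sum.inl p))
    (fun j => selfDualCoord N j e - d j) fun p => by simp [hd', selfDualCoord]
  have hC := antisymMatrix_apply N e.2.2 (fun p => Sum.inr (Sum.inr p))
    (fun j => selfDualCoord N j e - d j) fun p => by simp [hd', selfDualCoord]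
  rw [← Matrix.fromBlocks_one, Matrix.fromBlocks_smul, selfDual, Matrix.J, sub_eq_add_neg,
    Matrix.fromBlocks_neg, Matrix.fromBlocks_add, Matrix.fromBlocks_multiply]
  ext i j
  rcases i with i | i <;> rcases j with j | j <;>
    simp [entryMatrix, selfDualSign, selfDualIndex, hB, hC, hd, selfDualCoord, Matrix.one_apply,
      eq_comm] <;> ring

/-- Every independent entry of `A`, `B` and `C` occurs twice in the trace, so all variances are one
half. The sign `δ` is the determinant of the symplectic unit. -/
theorem selfDual_isEntryModel :
    IsEntryModel (fun _ => 1 / 2) (selfDualSign N) (selfDualIndex N)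
      (fun i : Fin N => (Sum.inl (i, i) : SelfDualIndex N)) (selfDualCoord N) (selfDual N) where
  coords := productCoords_selfDualCoord N
  pos _ := one_half_pos
  inj i j h := by simpa using h
  weight e := by
    have hB : ∀ e, ∑ i, ∑ j, (‖antisymMatrix N e i j‖ : ℂ) ^ 2 = ∑ p, 2 * (‖e p‖ : ℂ) ^ 2 := by
      intro e
      rw [sum_strict_triangle]
      · refine Finset.sum_congr rfl fun p _ => ?_
        simp [antisymMatrix, p.2]
      · intro i j
        rcases lt_trichotomy i j with h | h | h
        · simp [antisymMatrix, h, not_lt.mpr h.le]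
        · simp [h]
        · simp [antisymMatrix, h, not_lt.mpr h.le]
      · intro i
        simp [antisymMatrix]
    have hA : ∑ i, ∑ j, (‖e.1 j i‖ : ℂ) ^ 2 = ∑ i, ∑ j, (‖e.1 i j‖ : ℂ) ^ 2 :=
      Finset.sum_comm
    rw [gaussWeight_eq, prod_exp_neg_eq]
    congr 2
    simp only [Fintype.sum_sum_type, selfDual, Matrix.fromBlocks_apply₁₁, Matrix.fromBlocks_apply₁₂,
      Matrix.fromBlocks_apply₂₁, Matrix.fromBlocks_apply₂₂, Finset.sum_add_distrib, hB,
      Matrix.transpose_apply, Matrix.of_apply, hA, selfDualCoord, Fintype.sum_prod_type]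
    simp only [← Finset.mul_sum, ← Finset.sum_div]
    push_cast
    ring
  coords_star k e := by rcases k with k | k | k <;> rfl
  map_star e := by
    ext i j
    rcases i with i | i <;> rcases j with j | j <;>
      simp [selfDual, antisymMatrix, apply_dite (starRingEnd ℂ)]
  det := by
    refine ⟨(Matrix.J (Fin N) ℂ).det, Matrix.J_det_mul_J_det _ _, fun z e => ?_⟩
    rw [← sub_selfDual_mul_J N z e _ (by simp [eq_comm]) (by simp), Matrix.det_mul, mul_left_comm,
      Matrix.J_det_mul_J_det, mul_one]
  det_ne_zero := by
    have h0 : selfDual N 0 = 0 := by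
      ext i j
      rcases i with i | i <;> rcases j with j | j <;> simp [selfDual, antisymMatrix]
    -- The zero matrix at `z = 1` makes the antisymmetric matrix equal to the symplectic unit, which
    -- is invertible.
    have h1 := sub_selfDual_mul_J N 1 0 (Sum.elim (fun p => if p.1 = p.2 then 1 else 0) 0)
      (by simp) (by simp)
    refine ⟨fun j => selfDualCoord N j 0 -
      Sum.elim (fun p : Fin N × Fin N => if p.1 = p.2 then 1 else 0) 0 j, fun h => ?_⟩
    rw [← h1, h0, sub_zero, one_smul, one_mul] at h
    have := Matrix.J_det_mul_J_det (Fin N) ℂ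
    simp [h] at this

theorem selfDual_average : ∃ r : ℂ, r ≠ 0 ∧ ∀ z w,
    AverageConverges (selfDual N) (charPair z w) ∧ dAII N z w =
      r * (N.factorial / (2 * N).factorial * ∑ j ∈ Finset.range (N + 1),
        (2 * j).factorial / j.factorial * (4 * (z * w)) ^ (N - j) *
          truncExp (2 * j) (2 * (z * w))) := by
  have h := selfDual_isEntryModel N
  refine ⟨_, h.form_det_ne_zero, fun z w => ⟨(h.average_charPair z w).1, ?_⟩⟩
  have hS : (realEntrySystem (fun _ => 1 / 2) (selfDualSign N) (selfDualIndex N)).IsPaired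
      (-1) := by
    refine ⟨by ring, fun i j => ?_, fun i j f => ?_, fun i j k l => ?_⟩
    · rw [entrySystem_X, entrySystem_X, selfDualIndex_swap, selfDualSign_swap]
      simp
    · rw [entrySystem_D, entrySystem_D, selfDualIndex_swap, selfDualSign_swap]
      simp
    · have h2 : (2 : MvPolynomial (SelfDualIndex N) ℂ) = MvPolynomial.C 2 := rfl
      rw [entrySystem_D_X, h2, ← map_mul]
      have h3 := congrArg (fun x : ℝ => (MvPolynomial.C (x : ℂ) :
        MvPolynomial (SelfDualIndex N) ℂ)) (selfDualIndex_sign_mul N i j k l)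
      have h4 : (2 * if selfDualIndex N i j = selfDualIndex N k l then
          (((1 / 2 : ℝ) : ℂ) * (selfDualSign N i j : ℂ) * (selfDualSign N k l : ℂ)) else 0) =
          ((if selfDualIndex N i j = selfDualIndex N k l then
          selfDualSign N i j * selfDualSign N k l else 0 : ℝ) : ℂ) := by
        split_ifs <;> push_cast <;> ring
      rw [h4]
      refine h3.trans ?_
      split_ifs <;> simp
  have hT := entrySystem_isShift (fun _ : SelfDualIndex N => (((1 / 2 : ℝ)) : ℂ))
    (fun i j => (selfDualSign N i j : ℂ)) (selfDualIndex N)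
    (fun i : Fin N => (Sum.inl (i, i) : SelfDualIndex N))
    (fun i => Matrix.single (Sum.inl i) (Sum.inr i) 1 -
      Matrix.single (Sum.inr i) (Sum.inl i) 1) fun i k l => by
      have hl := strictSign_eq_zero_of_strictIndex_eq N (fun p => Sum.inr (Sum.inl p))
        (k := Sum.inl (i, i)) (by simp)
      have hr := strictSign_eq_zero_of_strictIndex_eq N (fun p => Sum.inr (Sum.inr p))
        (k := Sum.inl (i, i)) (by simp)
      rcases k with k | k <;> rcases l with l | l <;>
        simp [Matrix.single_apply, selfDualIndex, selfDualSign] <;>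
        grind [Complex.ofReal_zero]
  rw [dAII, (h.average_charPair z w).2, hS.form_shift_antisymm h.X_det_ne_zero hT,
    shiftSum_selfDualNorm, Fintype.card_fin]

end SelfDual

end NonHermitian

theorem proposition1 (N : ℕ) (hN : 1 ≤ N) (z w : ℂ) :
    -- class A
    (NonHermitian.AverageConverges (NonHermitian.ginibre N)
        (NonHermitian.charPair z (starRingEnd ℂ w)) ∧
      NonHermitian.dA N 0 0 ≠ 0 ∧
      NonHermitian.dA N z (starRingEnd ℂ w) / NonHermitian.dA N 0 0
        = NonHermitian.truncExp N (z * starRingEnd ℂ w) ∧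
      NonHermitian.dA N z (starRingEnd ℂ w) / NonHermitian.dA N 0 0
        = Complex.exp (z * starRingEnd ℂ w)
            * NonHermitian.regGammaQ ((N : ℂ) + 1) (z * starRingEnd ℂ w)) ∧
    -- class AI†
    (NonHermitian.AverageConverges (NonHermitian.symMatrix N)
        (NonHermitian.charPair z (starRingEnd ℂ w)) ∧
      NonHermitian.dAI N 0 0 ≠ 0 ∧
      NonHermitian.dAI N z (starRingEnd ℂ w) / NonHermitian.dAI N 0 0
        = NonHermitian.truncExp N (2 * (z * starRingEnd ℂ w))
          - 2 * (z * starRingEnd ℂ w) / ((N : ℂ) + 1)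
            * NonHermitian.truncExp (N - 1) (2 * (z * starRingEnd ℂ w)) ∧
      NonHermitian.dAI N z (starRingEnd ℂ w) / NonHermitian.dAI N 0 0
        = Complex.exp (2 * (z * starRingEnd ℂ w))
          * (NonHermitian.regGammaQ ((N : ℂ) + 1) (2 * (z * starRingEnd ℂ w))
            - 2 * (z * starRingEnd ℂ w) / ((N : ℂ) + 1)
              * NonHermitian.regGammaQ (N : ℂ) (2 * (z * starRingEnd ℂ w)))) ∧
    -- class AII†
    (NonHermitian.AverageConverges (NonHermitian.selfDual N)
        (NonHermitian.charPair z (starRingEnd ℂ w)) ∧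
      NonHermitian.dAII N 0 0 ≠ 0 ∧
      NonHermitian.dAII N z (starRingEnd ℂ w) / NonHermitian.dAII N 0 0
        = (N.factorial : ℂ) / ((2 * N).factorial : ℂ)
          * ∑ j ∈ Finset.range (N + 1), ((2 * j).factorial : ℂ) / (j.factorial : ℂ)
              * (4 * (z * starRingEnd ℂ w)) ^ (N - j)
              * NonHermitian.truncExp (2 * j) (2 * (z * starRingEnd ℂ w)) ∧
      NonHermitian.dAII N z (starRingEnd ℂ w) / NonHermitian.dAII N 0 0
        = Complex.exp (2 * (z * starRingEnd ℂ w))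
          * ((N.factorial : ℂ) / ((2 * N).factorial : ℂ))
          * ∑ j ∈ Finset.range (N + 1), ((2 * j).factorial : ℂ) / (j.factorial : ℂ)
              * (4 * (z * starRingEnd ℂ w)) ^ (N - j)
              * NonHermitian.regGammaQ (2 * (j : ℂ) + 1) (2 * (z * starRingEnd ℂ w))) := by
  have hA : ∀ r x : ℂ, r ≠ 0 → r * x / r = x := fun r x hr => mul_div_cancel_left₀ x hr
  set x := z * starRingEnd ℂ w with hx
  refine ⟨?_, ?_, ?_⟩
  · obtain ⟨r, hr, h⟩ := NonHermitian.ginibre_average N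
    have h0 : NonHermitian.dA N 0 0 = r := by
      rw [(h 0 0).2, mul_zero, NonHermitian.truncExp_zero, mul_one]
    have h1 : NonHermitian.dA N z (starRingEnd ℂ w) / NonHermitian.dA N 0 0 =
        NonHermitian.truncExp N x := by
      rw [h0, (h _ _).2, hA _ _ hr]
    exact ⟨(h _ _).1, h0 ▸ hr, h1, by rw [h1, NonHermitian.exp_mul_regGammaQ]⟩
  · obtain ⟨r, hr, h⟩ := NonHermitian.symMatrix_average N hN
    have h0 : NonHermitian.dAI N 0 0 = r := by
      rw [(h 0 0).2]
      simp [NonHermitian.truncExp_zero]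
    refine ⟨(h _ _).1, h0 ▸ hr, by rw [h0, (h _ _).2, hA _ _ hr], ?_⟩
    obtain ⟨M, rfl⟩ := Nat.exists_eq_add_of_le' hN
    rw [h0, (h _ _).2, hA _ _ hr, mul_sub, NonHermitian.exp_mul_regGammaQ, Nat.add_sub_cancel,
      ← NonHermitian.exp_mul_regGammaQ M]
    push_cast
    ring
  · obtain ⟨r, hr, h⟩ := NonHermitian.selfDual_average N
    have h2 : ((2 * N).factorial : ℂ) ≠ 0 := by exact_mod_cast (2 * N).factorial_ne_zero
    have h3 : (N.factorial : ℂ) ≠ 0 := by exact_mod_cast N.factorial_ne_zero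
    have h0 : NonHermitian.dAII N 0 0 = r := by
      -- At the origin only the term `j = N` survives, and it is cancelled by the prefactor.
      rw [(h 0 0).2, Finset.sum_range_succ, Finset.sum_eq_zero fun j hj => by
        rw [mul_zero, mul_zero, zero_pow (Nat.sub_pos_of_lt (Finset.mem_range.mp hj)).ne',
          mul_zero, zero_mul]]
      simp only [mul_zero, NonHermitian.truncExp_zero, Nat.sub_self, pow_zero, zero_add]
      field_simp
    refine ⟨(h _ _).1, h0 ▸ hr, by rw [h0, (h _ _).2, hA _ _ hr], ?_⟩
    rw [h0, (h _ _).2, hA _ _ hr, Finset.mul_sum, Finset.mul_sum]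
    refine Finset.sum_congr rfl fun j _ => ?_
    rw [← NonHermitian.exp_mul_regGammaQ]
    push_cast
    ring
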